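/- For a real function $h$ on $\mathbb{R}^N$ write $h^-=\inf h$, $h^+=\sup h$, and let $C^+(\mathbb{R}^N)$ be the set of continuous $h:\mathbb{R}^N\to\mathbb{R}$ with $1<h^-\le h^+<\infty$. Let $p\in C^+(\mathbb{R}^N)$ be Lipschitz continuous with $p^+<N$, and put $p^\star(x)=\frac{Np(x)}{N-p(x)}$. Let $L^{p(x)}(\mathbb{R}^N)$ be the set of measurable $u$ with $\int_{\mathbb{R}^N}|u(x)|^{p(x)}\,dx<\infty$, and let $W^{1,p(x)}(\mathbb{R}^N)$ be the set of $u\in L^{p(x)}(\mathbb{R}^N)$ whose weak gradient satisfies $|\nabla u|\in L^{p(x)}(\mathbb{R}^N)$. Let $q\in C^+(\mathbb{R}^N)$ and let $\lambda:\mathbb{R}^N\times\mathbb{R}^N\to\mathbb{R}$ satisfy $\lambda^+:=\sup\lambda<N$ and $$\frac1{q(x)}+\frac{\lambda(x,y)}{N}+\frac1{q(y)}=2\qquad\text{for all }x,y\in\mathbb{R}^N .$$ Let $r\in C^+(\mathbb{R}^N)$ satisfy $p(x)\le r(x)q^-\le r(x)q^+\le p^\star(x)$ for all $x\in\mathbb{R}^N$.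 Then for every $u\in W^{1,p(x)}(\mathbb{R}^N)$ the function $x\mapsto|u(x)|^{r(x)}$ belongs to $L^{q^-}(\mathbb{R}^N)\cap L^{q^+}(\mathbb{R}^N)$. Moreover, there is a constant $C>0$, independent of $u$, such that for every $u\in W^{1,p(x)}(\mathbb{R}^N)$ the function $(x,y)\mapsto\frac{|u(x)|^{r(x)}|u(y)|^{r(y)}}{|x-y|^{\lambda(x,y)}}$ is integrable on $\mathbb{R}^N\times\mathbb{R}^N$ and $$\left|\int_{\mathbb{R}^N}\int_{\mathbb{R}^N}\frac{|u(x)|^{r(x)}|u(y)|^{r(y)}}{|x-y|^{\lambda(x,y)}}\,dx\,dy\right|\le C\left(\big\||u|^{r(\cdot)}\big\|_{L^{q^+}(\mathbb{R}^N)}^2+\big\||u|^{r(\cdot)}\big\|_{L^{q^-}(\mathbb{R}^N)}^2\right).$$ -/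

import Mathlib

open MeasureTheory
open scoped ContDiff

noncomputable section

/-- The Euclidean space `ℝᴺ`. -/
abbrev RN (N : ℕ) : Type := EuclideanSpace ℝ (Fin N)

/-- `h⁻ = inf h`. -/
def lowerExp {X : Type*} (h : X → ℝ) : ℝ := ⨅ x, h x

/-- `h⁺ = sup h`. -/
def upperExp {X : Type*} (h : X → ℝ) : ℝ := ⨆ x, h x

/-- The class `C⁺(ℝᴺ)` of continuous exponents with `1 < h⁻ ≤ h⁺ < ∞`. -/
structure IsCPlus {N : ℕ} (h : RN N → ℝ) : Prop where
  continuous : Continuous h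
  bddBelow : BddBelow (Set.range h)
  bddAbove : BddAbove (Set.range h)
  one_lt : 1 < lowerExp h

/-- `f ∈ L^{p(x)}(ℝᴺ)`: `f` is measurable (up to a null set) and `∫ |f(x)|^{p(x)} dx < ∞`. -/
def MemVarLp {N : ℕ} {F : Type*} [NormedAddCommGroup F]
    (p : RN N → ℝ) (f : RN N → F) : Prop :=
  AEStronglyMeasurable f volume ∧
    ∫⁻ x, ENNReal.ofReal (‖f x‖ ^ p x) < ⊤

/-- `g` is the weak (distributional) gradient of `u` on `ℝᴺ`. -/
def HasWeakGradient {N : ℕ} (u : RN N → ℝ) (g : RN N → RN N) : Prop :=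
  LocallyIntegrable u volume ∧ LocallyIntegrable g volume ∧
    ∀ φ : RN N → ℝ, ContDiff ℝ ∞ φ → HasCompactSupport φ → ∀ i : Fin N,
      ∫ x, u x * fderiv ℝ φ x (EuclideanSpace.single i 1) = - ∫ x, g x i * φ x

/-- `u ∈ W^{1,p(x)}(ℝᴺ)`: both `u` and its weak gradient lie in `L^{p(x)}(ℝᴺ)`. -/
def MemVarSobolev {N : ℕ} (p : RN N → ℝ) (u : RN N → ℝ) : Prop :=
  MemVarLp p u ∧ ∃ g : RN N → RN N, HasWeakGradient u g ∧ MemVarLp p g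

/-- The critical Sobolev exponent `p*(x) = N p(x) / (N - p(x))`, used for `p⁺ < N`. -/
def criticalExp {N : ℕ} (p : RN N → ℝ) (x : RN N) : ℝ := N * p x / (N - p x)

/-- The class `𝓜` of those `r ∈ C⁺(ℝᴺ)` with `p ≤ r q⁻ ≤ r q⁺ ≤ p*` everywhere. -/
structure IsAdmissible {N : ℕ} (p q r : RN N → ℝ) : Prop where
  isCPlus : IsCPlus r
  le_lower : ∀ x, p x ≤ r x * lowerExp q
  lower_le_upper : ∀ x, r x * lowerExp q ≤ r x * upperExp q
  upper_le : ∀ x, r x * upperExp q ≤ criticalExp p x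

/-- The norm of `L^s(ℝᴺ)` for a constant real exponent `s` (finite on `L^s`). -/
def lpNormReal {N : ℕ} (s : ℝ) (f : RN N → ℝ) : ℝ :=
  (eLpNorm f (ENNReal.ofReal s) volume).toReal

end

/-! Two facts combine: an embedding W^{1,p(x)} ⊆ L^{s(x)} for p ≤ s ≤ p*, used with s = r q⁻ and s =
r q⁺, and a Hardy-Littlewood-Sobolev inequality of variable order.

For the latter, the exponent relation forces λ(x,y) = N(2 - 1/q(x) - 1/q(y)), so λ lies between 2N(1
- 1/q⁻) and 2N(1 - 1/q⁺), and its diagonal values show that the larger bound is below N. Hence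
|x-y|^{-λ} is at most the sum of the two extreme constant-order kernels, which pair with L^{q⁻} and
L^{q⁺} (`variable_hardy_littlewood_sobolev`). For constant order, symmetry leaves only pairs with
f(y) ≤ f(x); there, splitting the Riesz potential at an optimal radius bounds it by C ‖f‖^{2-q}
f(x)^{q-1} (`riesz_potential_le`).

The embedding comes from the Gagliardo-Nirenberg-Sobolev inequality for integrable gradients,
applied to v = |U|^{γ(P)} with γ(s) = s(N-1)/(N-s), smoothed and cut off near zero (`powCut`), so
that v^{N/(N-1)} has critical growth. Young's inequality and a bound on ∇P control |∇v| by
v^{N/(N-1)} + |U|^P + |∇U|^P. Thus X = ∫ v^{N/(N-1)} satisfies X^{(N-1)/N} ≤ C(X + Y), with Y the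
modular of U and ∇U. For a suitable a this excludes X = a whenever Y ≤ a, so deforming U to 0 traps
X below a (`integral_powCut_le_of_modular_le`). Mollification, cutoffs, smooth exponents slightly
below p, and Fatou's lemma carry the bound to a small multiple of any Sobolev function
(`exists_lintegral_powCut_lt_top`). Undoing the scaling costs a constant, because the exponents are
bounded. -/

/-! ### Radial integrals and the diagonal Hardy-Littlewood-Sobolev inequality -/

/-- Polar coordinates for the lower integral of a nonnegative radial function. -/
lemma lintegral_ofReal_fun_norm {N : ℕ} (hN : 0 < N) {f : ℝ → ℝ} (hf : ∀ t, 0 ≤ t → 0 ≤ f t)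
    (hint : IntegrableOn (fun y : ℝ => y ^ (N - 1) * f y) (Set.Ioi 0)) :
    ∫⁻ x : RN N, ENNReal.ofReal (f ‖x‖) =
      ENNReal.ofReal (N * (volume : Measure (RN N)).real (Metric.ball 0 1) *
        ∫ y in Set.Ioi (0 : ℝ), y ^ (N - 1) * f y) := by
  have : Nonempty (Fin N) := ⟨⟨0, hN⟩⟩
  have hi : Integrable (fun x : RN N => f ‖x‖) := by
    rw [integrable_fun_norm_addHaar]
    simpa using hint
  rw [← ofReal_integral_eq_lintegral_ofReal hi
      (Filter.Eventually.of_forall fun x => hf _ (norm_nonneg x)), integral_fun_norm_addHaar]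
  simp [mul_assoc]

lemma lintegral_rpow_norm_inside {N : ℕ} (hN : 0 < N) {l ρ : ℝ} (hl : l < N) (hρ : 0 < ρ) :
    ∫⁻ x : RN N, ENNReal.ofReal (if ‖x‖ ≤ ρ then ‖x‖ ^ (-l) else 0) =
      ENNReal.ofReal (N * (volume : Measure (RN N)).real (Metric.ball 0 1) *
        (ρ ^ (N - l) / (N - l))) := by
  have key : ∀ y ∈ Set.Ioi (0 : ℝ), y ^ (N - 1) * (if y ≤ ρ then y ^ (-l) else 0) =
      (Set.Ioc 0 ρ).indicator (fun y => y ^ (N - 1 - l)) y := by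
    intro y hy
    have hy' : 0 < y := hy
    by_cases h : y ≤ ρ
    · rw [Set.indicator_of_mem (Set.mem_Ioc.2 ⟨hy', h⟩), if_pos h, ← Real.rpow_natCast,
        ← Real.rpow_add hy', Nat.cast_sub (by omega)]
      simp [sub_eq_add_neg]
    · rw [Set.indicator_of_notMem (fun hm => h hm.2), if_neg h, mul_zero]
  -- Integrability at the origin is where l < N enters: N - 1 - l > -1.
  have hii : IntervalIntegrable (fun y : ℝ => y ^ (N - 1 - l)) volume 0 ρ :=
    intervalIntegral.intervalIntegrable_rpow' (by linarith)
  rw [intervalIntegrable_iff_integrableOn_Ioc_of_le hρ.le] at hii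
  rw [lintegral_ofReal_fun_norm (f := fun t => if t ≤ ρ then t ^ (-l) else 0) hN]
  · rw [setIntegral_congr_fun measurableSet_Ioi key, setIntegral_indicator measurableSet_Ioc,
      Set.inter_eq_right.2 (fun y hy => hy.1), ← intervalIntegral.integral_of_le hρ.le,
      integral_rpow (Or.inl (by linarith)), Real.zero_rpow (by linarith)]
    ring_nf
  · intro t ht
    split_ifs <;> positivity
  · rw [integrableOn_congr_fun key measurableSet_Ioi]
    exact (hii.integrable_indicator measurableSet_Ioc).integrableOn

/-- The power 2N arises from Hölder's inequality on the far part of the kernel: for q = 2N/(2N - l)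
the conjugate exponent is 2N/l, which turns |z|^{-l} into |z|^{-2N}. -/
lemma lintegral_rpow_norm_outside {N : ℕ} (hN : 0 < N) {ρ : ℝ} (hρ : 0 < ρ) :
    ∫⁻ x : RN N, ENNReal.ofReal (if ρ < ‖x‖ then ‖x‖ ^ (-(2 * N : ℝ)) else 0) =
      ENNReal.ofReal ((volume : Measure (RN N)).real (Metric.ball 0 1) * ρ ^ (-(N : ℝ))) := by
  have hN' : (0 : ℝ) < N := by exact_mod_cast hN
  have key : ∀ y ∈ Set.Ioi (0 : ℝ), y ^ (N - 1) * (if ρ < y then y ^ (-(2 * N : ℝ)) else 0) =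
      (Set.Ioi ρ).indicator (fun y => y ^ (-(N : ℝ) - 1)) y := by
    intro y hy
    have hy' : 0 < y := hy
    by_cases h : ρ < y
    · rw [Set.indicator_of_mem (Set.mem_Ioi.2 h), if_pos h, ← Real.rpow_natCast,
        ← Real.rpow_add hy', Nat.cast_sub (by omega)]
      congr 1
      push_cast
      ring
    · rw [Set.indicator_of_notMem (show y ∉ Set.Ioi ρ from h), if_neg h, mul_zero]
  have hlt : -(N : ℝ) - 1 < -1 := by linarith
  rw [lintegral_ofReal_fun_norm (f := fun t => if ρ < t then t ^ (-(2 * N : ℝ)) else 0) hN]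
  · rw [setIntegral_congr_fun measurableSet_Ioi key, setIntegral_indicator measurableSet_Ioi,
      Set.inter_eq_right.2 (Set.Ioi_subset_Ioi hρ.le), integral_Ioi_rpow_of_lt hlt hρ]
    congr 1
    rw [sub_add_cancel]
    field_simp
  · intro t ht
    split_ifs <;> positivity
  · rw [integrableOn_congr_fun key measurableSet_Ioi]
    exact ((integrableOn_Ioi_rpow_of_lt hlt hρ).integrable_indicator measurableSet_Ioi).integrableOn

/-- The Riesz potential of a function bounded by `a` is controlled by `a` and its `L^q` norm. -/
lemma riesz_potential_le {N : ℕ} (hN : 0 < N) {l : ℝ} (hl0 : 0 < l) (hl : l < N) :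
    ∃ C : ℝ, 0 < C ∧ ∀ (f : RN N → ℝ), Measurable f → (∀ x, 0 ≤ f x) →
      ∀ (L a : ℝ), 0 < L → 0 < a →
      (∫⁻ y, ENNReal.ofReal (f y) ^ (2 * N / (2 * N - l))) ^ (1 / (2 * N / (2 * N - l))) ≤
        ENNReal.ofReal L → ∀ x : RN N,
      ∫⁻ y, (if f y ≤ a then ENNReal.ofReal (f y) * ENNReal.ofReal (‖x - y‖ ^ (-l)) else 0) ≤
        ENNReal.ofReal (C * L ^ (2 - 2 * N / (2 * N - l)) * a ^ (2 * N / (2 * N - l) - 1)) := by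
  have hN' : (0 : ℝ) < N := by exact_mod_cast hN
  set b := (volume : Measure (RN N)).real (Metric.ball 0 1) with hb
  have hbpos : 0 < b := by
    rw [hb, Measure.real, ENNReal.toReal_pos_iff]
    exact ⟨Metric.measure_ball_pos _ _ one_pos, measure_ball_lt_top⟩
  have hNl : 0 < N - l := by linarith
  set q : ℝ := 2 * N / (2 * N - l) with hq
  have h2Nl : 0 < 2 * N - l := by linarith
  have hq1 : 1 < q := by rw [hq, one_lt_div h2Nl]; linarith
  set q' : ℝ := 2 * N / l with hq'
  have hconj : q.HolderConjugate q' := by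
    rw [Real.holderConjugate_iff]
    refine ⟨hq1, ?_⟩
    rw [hq, hq']
    field_simp
    ring
  refine ⟨N * b / (N - l) + b ^ (1 / q'), by positivity, ?_⟩
  intro f hf hf0 L a hL ha hLf x
  -- This radius balances the near part a ρ^{N-l}, where f ≤ a is used, against the far part L
  -- ρ^{-l/2}, where Hölder is used. Both then equal L^{2-q} a^{q-1}, and the constant is the sum of
  -- their coefficients.
  set ρ : ℝ := (L / a) ^ (2 / (2 * N - l)) with hρ
  have hρ0 : 0 < ρ := by positivity
  have hstep : ∀ y, (if f y ≤ a then ENNReal.ofReal (f y) * ENNReal.ofReal (‖x - y‖ ^ (-l)) else 0)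
      ≤ ENNReal.ofReal a * ENNReal.ofReal (if ‖x - y‖ ≤ ρ then ‖x - y‖ ^ (-l) else 0) +
        ENNReal.ofReal (f y) * ENNReal.ofReal (if ρ < ‖x - y‖ then ‖x - y‖ ^ (-l) else 0) := by
    intro y
    by_cases h1 : f y ≤ a
    · by_cases h2 : ‖x - y‖ ≤ ρ
      · simp only [h1, h2, if_true]
        exact le_add_right (by gcongr)
      · simp [h1, h2, not_le.1 h2]
    · simp [h1]
  have hm1 : Measurable fun z : RN N => ENNReal.ofReal (if ‖z‖ ≤ ρ then ‖z‖ ^ (-l) else 0) := by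
    refine (Measurable.ite (measurableSet_le (by fun_prop) (by fun_prop)) (by fun_prop)
      measurable_const).ennreal_ofReal
  have hm2 : Measurable fun z : RN N => ENNReal.ofReal (if ρ < ‖z‖ then ‖z‖ ^ (-l) else 0) := by
    refine (Measurable.ite (measurableSet_lt (by fun_prop) (by fun_prop)) (by fun_prop)
      measurable_const).ennreal_ofReal
  have hx : Measurable fun y : RN N => x - y := measurable_const.sub measurable_id
  have hm1x : Measurable fun y : RN N =>
      ENNReal.ofReal (if ‖x - y‖ ≤ ρ then ‖x - y‖ ^ (-l) else 0) := hm1.comp hx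
  have hm2x : Measurable fun y : RN N =>
      ENNReal.ofReal (if ρ < ‖x - y‖ then ‖x - y‖ ^ (-l) else 0) := hm2.comp hx
  have hin : ∫⁻ y, ENNReal.ofReal a * ENNReal.ofReal (if ‖x - y‖ ≤ ρ then ‖x - y‖ ^ (-l) else 0)
      = ENNReal.ofReal (a * (N * b * (ρ ^ (N - l) / (N - l)))) := by
    rw [lintegral_const_mul _ hm1x,
      lintegral_sub_left_eq_self
        (fun z : RN N => ENNReal.ofReal (if ‖z‖ ≤ ρ then ‖z‖ ^ (-l) else 0)) x,
      lintegral_rpow_norm_inside hN hl hρ0, ← ENNReal.ofReal_mul ha.le]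
  have hout : ∫⁻ y, ENNReal.ofReal (f y) *
      ENNReal.ofReal (if ρ < ‖x - y‖ then ‖x - y‖ ^ (-l) else 0) ≤
        ENNReal.ofReal (L * (b * ρ ^ (-(N : ℝ))) ^ (1 / q')) := by
    refine (ENNReal.lintegral_mul_le_Lp_mul_Lq volume hconj hf.ennreal_ofReal.aemeasurable
      hm2x.aemeasurable).trans ?_
    rw [ENNReal.ofReal_mul hL.le]
    refine mul_le_mul' hLf ?_
    have hpow : ∀ y, ENNReal.ofReal (if ρ < ‖x - y‖ then ‖x - y‖ ^ (-l) else 0) ^ q' =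
        ENNReal.ofReal (if ρ < ‖x - y‖ then ‖x - y‖ ^ (-(2 * N : ℝ)) else 0) := by
      intro y
      rw [ENNReal.ofReal_rpow_of_nonneg (by split_ifs <;> positivity) hconj.symm.nonneg]
      congr 1
      split_ifs with h
      · rw [← Real.rpow_mul (norm_nonneg _)]
        congr 1
        rw [hq']
        field_simp
      · exact Real.zero_rpow hconj.symm.ne_zero
    rw [lintegral_congr hpow, lintegral_sub_left_eq_self
        (fun z : RN N => ENNReal.ofReal (if ρ < ‖z‖ then ‖z‖ ^ (-(2 * N : ℝ)) else 0)) x,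
      lintegral_rpow_norm_outside hN hρ0, ENNReal.ofReal_rpow_of_nonneg (by positivity)
        (by have := hconj.symm.pos; positivity)]
  refine (lintegral_mono hstep).trans ?_
  rw [lintegral_add_left (hm1x.const_mul _), hin]
  refine (add_le_add_right hout _).trans ?_
  rw [← ENNReal.ofReal_add (by positivity) (by positivity)]
  refine ENNReal.ofReal_le_ofReal (le_of_eq ?_)
  have e1 : a * ρ ^ (N - l) = L ^ (2 - q) * a ^ (q - 1) := by
    have h1 : 2 / (2 * N - l) * (N - l) = 2 - q := by rw [hq]; field_simp; ring
    have h2 : a ^ (q - 1) = a / a ^ (2 - q) := by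
      rw [show q - 1 = 1 - (2 - q) by ring, Real.rpow_sub ha, Real.rpow_one]
    rw [hρ, ← Real.rpow_mul (by positivity), h1, Real.div_rpow hL.le ha.le, h2]
    ring
  have e2 : L * (ρ ^ (-(N : ℝ))) ^ (1 / q') = L ^ (2 - q) * a ^ (q - 1) := by
    have h1 : 2 / (2 * N - l) * (-(N : ℝ) * (1 / q')) = -(q - 1) := by
      rw [hq, hq']; field_simp; ring
    have h2 : L ^ (2 - q) = L / L ^ (q - 1) := by
      rw [show 2 - q = 1 - (q - 1) by ring, Real.rpow_sub hL, Real.rpow_one]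
    rw [hρ, ← Real.rpow_mul (by positivity), ← Real.rpow_mul (by positivity), h1,
      Real.rpow_neg (by positivity), Real.div_rpow hL.le ha.le, h2]
    field_simp
  rw [Real.mul_rpow hbpos.le (by positivity)]
  calc _ = N * b / (N - l) * (a * ρ ^ (N - l)) + b ^ (1 / q') * (L * (ρ ^ (-(N : ℝ))) ^ (1 / q'))
        := by ring
    _ = _ := by rw [e1, e2]; ring

/-- The diagonal Hardy-Littlewood-Sobolev inequality for measurable nonnegative functions. -/
lemma hardy_littlewood_sobolev_of_measurable {N : ℕ} (hN : 0 < N) {l : ℝ}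
    (hl0 : 0 < l) (hl : l < N) :
    ∃ C : ℝ, 0 < C ∧ ∀ (f : RN N → ℝ), Measurable f → (∀ x, 0 ≤ f x) →
      ∫⁻ x, ∫⁻ y, ENNReal.ofReal (f x) * ENNReal.ofReal (f y) * ENNReal.ofReal (‖x - y‖ ^ (-l)) ≤
        ENNReal.ofReal C * ((∫⁻ y, ENNReal.ofReal (f y) ^ (2 * N / (2 * N - l))) ^
          (1 / (2 * N / (2 * N - l)))) ^ (2 : ℝ) := by
  obtain ⟨C, hC, hpot⟩ := riesz_potential_le hN hl0 hl
  have hN' : (0 : ℝ) < N := by exact_mod_cast hN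
  have h2Nl : 0 < 2 * N - l := by linarith
  refine ⟨2 * C, by positivity, ?_⟩
  intro f hf hf0
  set q : ℝ := 2 * N / (2 * N - l) with hq
  have hq1 : 1 < q := by rw [hq, one_lt_div h2Nl]; linarith
  set A : ENNReal := (∫⁻ y, ENNReal.ofReal (f y) ^ q) ^ (1 / q) with hA
  have hAq : ∫⁻ y, ENNReal.ofReal (f y) ^ q = A ^ q := by
    rw [hA, ← ENNReal.rpow_mul, one_div_mul_cancel (by linarith), ENNReal.rpow_one]
  rcases eq_or_ne A ⊤ with hAt | hAt
  · rw [hAt, ENNReal.top_rpow_of_pos two_pos, ENNReal.mul_top (by simpa using hC)]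
    exact le_top
  rcases eq_or_ne A 0 with hA0 | hA0
  · rw [hA0, ENNReal.zero_rpow_of_pos (by linarith), lintegral_eq_zero_iff (by fun_prop)] at hAq
    have : ∀ᵐ x, ENNReal.ofReal (f x) = 0 := by
      filter_upwards [hAq] with x hx
      simpa [ENNReal.rpow_eq_zero_iff, not_lt.2 (show (0:ℝ) ≤ q by linarith),
        show 0 < q by linarith] using hx
    rw [lintegral_congr_ae (g := fun _ => 0)]
    · simp
    · filter_upwards [this] with x hx
      simp [hx]
  set L := A.toReal with hL
  have hL0 : 0 < L := ENNReal.toReal_pos hA0 hAt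
  have hAL : A = ENNReal.ofReal L := (ENNReal.ofReal_toReal hAt).symm
  set k : RN N → RN N → ENNReal := fun x y =>
    ENNReal.ofReal (f x) * ENNReal.ofReal (f y) * ENNReal.ofReal (‖x - y‖ ^ (-l)) with hk
  -- By symmetry of the kernel it suffices to integrate over f y ≤ f x. There the potential bound
  -- applies with a = f x, and the factor f x raises f(x)^{q-1} to f(x)^q, whose integral is finite.
  set F : RN N → RN N → ENNReal := fun x y => if f y ≤ f x then k x y else 0 with hF
  have hFm : Measurable (Function.uncurry F) := by
    refine Measurable.ite (measurableSet_le (hf.comp measurable_snd) (hf.comp measurable_fst)) ?_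
      measurable_const
    show Measurable fun z : RN N × RN N =>
      ENNReal.ofReal (f z.1) * ENNReal.ofReal (f z.2) * ENNReal.ofReal (‖z.1 - z.2‖ ^ (-l))
    fun_prop
  have hkF : ∀ x y, k x y ≤ F x y + F y x := by
    intro x y
    have hsymm : k y x = k x y := by
      simp only [hk, norm_sub_rev y x]; ring
    rcases le_total (f y) (f x) with h | h
    · simp only [hF, h, if_true]; exact le_self_add
    · simp only [hF, h, if_true, hsymm]; exact le_add_self
  have hinner : ∀ x, ∫⁻ y, F x y ≤ ENNReal.ofReal (C * L ^ (2 - q)) * ENNReal.ofReal (f x) ^ q := by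
    intro x
    rcases (hf0 x).eq_or_lt with h0 | h0
    · have : ∀ y, F x y = 0 := by
        intro y
        simp only [hF, hk, ← h0]
        simp
      simp [this]
    have h1 : ∀ y, F x y = ENNReal.ofReal (f x) * (if f y ≤ f x then
        ENNReal.ofReal (f y) * ENNReal.ofReal (‖x - y‖ ^ (-l)) else 0) := by
      intro y
      simp only [hF, hk]
      split_ifs <;> simp [mul_assoc]
    have hmm : Measurable fun y => (if f y ≤ f x then
        ENNReal.ofReal (f y) * ENNReal.ofReal (‖x - y‖ ^ (-l)) else 0) :=
      Measurable.ite (measurableSet_le hf measurable_const) (by fun_prop) measurable_const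
    rw [lintegral_congr h1, lintegral_const_mul _ hmm]
    refine (mul_le_mul_right (hpot f hf hf0 L (f x) hL0 h0 hAL.le x) _).trans (le_of_eq ?_)
    rw [← ENNReal.ofReal_mul h0.le, ENNReal.ofReal_rpow_of_pos h0,
      ← ENNReal.ofReal_mul (by positivity)]
    congr 1
    rw [Real.rpow_sub_one h0.ne']
    field_simp
  calc ∫⁻ x, ∫⁻ y, k x y ≤ ∫⁻ x, ∫⁻ y, (F x y + F y x) :=
        lintegral_mono fun x => lintegral_mono fun y => hkF x y
    _ = ∫⁻ x, ((∫⁻ y, F x y) + ∫⁻ y, F y x) := by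
        refine lintegral_congr fun x => lintegral_add_left ?_ _
        exact hFm.comp (measurable_const.prodMk measurable_id)
    _ = (∫⁻ x, ∫⁻ y, F x y) + ∫⁻ x, ∫⁻ y, F y x := lintegral_add_left hFm.lintegral_prod_right' _
    _ = 2 * ∫⁻ x, ∫⁻ y, F x y := by
        rw [lintegral_lintegral_swap (f := fun x y => F y x)
          (hFm.comp measurable_swap).aemeasurable, two_mul]
    _ ≤ 2 * ∫⁻ x, ENNReal.ofReal (C * L ^ (2 - q)) * ENNReal.ofReal (f x) ^ q := by
        gcongr with x
        exact hinner x
    _ = ENNReal.ofReal (2 * C) * A ^ (2 : ℝ) := by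
        rw [lintegral_const_mul _ (by fun_prop), hAq, hAL,
          ENNReal.ofReal_rpow_of_pos hL0, ENNReal.ofReal_rpow_of_pos hL0,
          ← ENNReal.ofReal_mul (by positivity), ← ENNReal.ofReal_mul (by positivity),
          show (2 : ENNReal) = ENNReal.ofReal 2 by simp, ← ENNReal.ofReal_mul two_pos.le]
        congr 1
        have : L ^ (2 : ℝ) = L ^ (2 - q) * L ^ q := by rw [← Real.rpow_add hL0]; congr 1; ring
        rw [this]
        ring

/-- The diagonal Hardy-Littlewood-Sobolev inequality. -/
lemma hardy_littlewood_sobolev {N : ℕ} (hN : 0 < N) {l : ℝ} (hl0 : 0 < l) (hl : l < N) :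
    ∃ C : ℝ, 0 < C ∧ ∀ (f : RN N → ℝ), AEMeasurable f → (∀ x, 0 ≤ f x) →
      ∫⁻ x, ∫⁻ y, ENNReal.ofReal (f x) * ENNReal.ofReal (f y) * ENNReal.ofReal (‖x - y‖ ^ (-l)) ≤
        ENNReal.ofReal C *
          eLpNorm f (ENNReal.ofReal (2 * N / (2 * N - l))) volume ^ 2 := by
  obtain ⟨C, hC, h⟩ := hardy_littlewood_sobolev_of_measurable hN hl0 hl
  have hN' : (0 : ℝ) < N := by exact_mod_cast hN
  have h2Nl : 0 < 2 * N - l := by linarith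
  refine ⟨C, hC, fun f hf hf0 => ?_⟩
  -- Truncating the measurable representative at 0 makes it nonnegative everywhere rather than
  -- almost everywhere.
  set g : RN N → ℝ := fun x => max (hf.mk f x) 0 with hg
  have hfg : f =ᵐ[volume] g := by
    filter_upwards [hf.ae_eq_mk] with x hx
    simp only [hg]
    rw [← hx, max_eq_left (hf0 x)]
  have hgm : Measurable g := hf.measurable_mk.max measurable_const
  have hg0 : ∀ x, 0 ≤ g x := fun x => le_max_right _ _
  have hq0 : 0 < 2 * N / (2 * N - l) := by positivity
  rw [eLpNorm_congr_ae hfg]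
  have e1 : ∫⁻ x, ∫⁻ y, ENNReal.ofReal (f x) * ENNReal.ofReal (f y) *
        ENNReal.ofReal (‖x - y‖ ^ (-l)) =
      ∫⁻ x, ∫⁻ y, ENNReal.ofReal (g x) * ENNReal.ofReal (g y) *
        ENNReal.ofReal (‖x - y‖ ^ (-l)) := by
    refine lintegral_congr_ae ?_
    filter_upwards [hfg] with x hx
    refine lintegral_congr_ae ?_
    filter_upwards [hfg] with y hy
    rw [hx, hy]
  rw [e1]
  refine (h g hgm hg0).trans (le_of_eq ?_)
  rw [eLpNorm_eq_lintegral_rpow_enorm_toReal (by simpa using hq0) ENNReal.ofReal_ne_top,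
    ENNReal.toReal_ofReal hq0.le, ENNReal.rpow_two]
  congr 4
  funext x
  rw [Real.enorm_of_nonneg (hg0 x)]

/-! ### The smoothed power with variable exponent and its derivative bounds -/

/-- The derivative of the smooth transition function vanishes outside `(0, 1)`. -/
lemma deriv_smoothTransition_eq_zero {y : ℝ} (hy : y ≤ 0 ∨ 1 ≤ y) :
    deriv Real.smoothTransition y = 0 := by
  rcases hy with hy | hy
  · refine IsLocalMin.deriv_eq_zero (Filter.Eventually.of_forall fun z => ?_)
    rw [Real.smoothTransition.zero_of_nonpos hy]
    exact Real.smoothTransition.nonneg z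
  · refine IsLocalMax.deriv_eq_zero (Filter.Eventually.of_forall fun z => ?_)
    rw [Real.smoothTransition.one_of_one_le hy]
    exact Real.smoothTransition.le_one z

lemma exists_deriv_smoothTransition_le :
    ∃ c : ℝ, 0 < c ∧ ∀ y, |deriv Real.smoothTransition y| ≤ c := by
  have hcont : Continuous (deriv Real.smoothTransition) :=
    (Real.smoothTransition.contDiff (n := 1)).continuous_deriv le_rfl
  obtain ⟨c, hc⟩ := isCompact_Icc.exists_bound_of_continuousOn (s := Set.Icc (0 : ℝ) 1)
    hcont.continuousOn
  refine ⟨max c 1, by positivity, fun y => ?_⟩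
  by_cases hy : y ∈ Set.Icc (0 : ℝ) 1
  · exact (hc y hy).trans (le_max_left _ _)
  · rw [deriv_smoothTransition_eq_zero, abs_zero]
    · positivity
    · by_contra! h
      exact hy ⟨h.1.le, h.2.le⟩

/-- The exponent `s (N - 1) / (N - s)`, which turns the critical exponent `N s / (N - s)` into
`N / (N - 1)`. -/
noncomputable def chainExp (N : ℕ) (s : ℝ) : ℝ := s * (N - 1) / (N - s)

/-- A smooth version of `|t| ^ chainExp N s`, vanishing for `|t| ≤ 1`. -/
noncomputable def powCut (N : ℕ) (t s : ℝ) : ℝ :=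
  Real.smoothTransition (t ^ 2 - 1) * Real.exp (chainExp N s / 2 * Real.log (1 + t ^ 2))

lemma powCut_nonneg (N : ℕ) (t s : ℝ) : 0 ≤ powCut N t s :=
  mul_nonneg (Real.smoothTransition.nonneg _) (Real.exp_pos _).le

lemma powCut_zero (N : ℕ) (s : ℝ) : powCut N 0 s = 0 := by
  simp [powCut, Real.smoothTransition.zero_of_nonpos]

/-- Partial derivative of `powCut` in its first argument. -/
noncomputable def powCutDerivFst (N : ℕ) (t s : ℝ) : ℝ :=
  (deriv Real.smoothTransition (t ^ 2 - 1) * (2 * t) +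
    Real.smoothTransition (t ^ 2 - 1) * (chainExp N s / 2 * (2 * t / (1 + t ^ 2)))) *
      Real.exp (chainExp N s / 2 * Real.log (1 + t ^ 2))

/-- Partial derivative of `powCut` in its second argument. -/
noncomputable def powCutDerivSnd (N : ℕ) (t s : ℝ) : ℝ :=
  Real.smoothTransition (t ^ 2 - 1) * (N * (N - 1) / (N - s) ^ 2 / 2 * Real.log (1 + t ^ 2)) *
      Real.exp (chainExp N s / 2 * Real.log (1 + t ^ 2))

/-- The source space is arbitrary because two cases are needed: ℝᴺ, for the gradient of `powCut N U
P`, and ℝ × ℝ with the coordinate projections, for joint continuity in (t, s). -/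
lemma hasFDerivAt_powCut_comp {N : ℕ} {E : Type*} [NormedAddCommGroup E] [NormedSpace ℝ E]
    {U P : E → ℝ} {U' P' : E →L[ℝ] ℝ} {x : E} (hU : HasFDerivAt U U' x) (hP : HasFDerivAt P P' x)
    (hx : P x ≠ N) :
    HasFDerivAt (fun y => powCut N (U y) (P y))
      (powCutDerivFst N (U x) (P x) • U' + powCutDerivSnd N (U x) (P x) • P') x := by
  have hNP : (N : ℝ) - P x ≠ 0 := sub_ne_zero.2 hx.symm
  have hg : HasDerivAt (chainExp N) (N * (N - 1) / (N - P x) ^ 2) (P x) := by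
    have h1 : HasDerivAt (fun s : ℝ => s * ((N : ℝ) - 1)) (1 * (N - 1)) (P x) :=
      (hasDerivAt_id _).mul_const _
    have h2 : HasDerivAt (fun s : ℝ => (N : ℝ) - s) (-1) (P x) := by
      simpa using (hasDerivAt_id (P x)).const_sub (N : ℝ)
    refine (h1.div h2 hNP).congr_deriv ?_
    congr 1
    ring
  have hsq : HasFDerivAt (fun y => U y ^ 2) ((2 * U x) • U') x := by
    simpa using hU.pow 2
  have hW : (1 : ℝ) + U x ^ 2 ≠ 0 := by positivity
  have hS : HasFDerivAt (fun y => Real.smoothTransition (U y ^ 2 - 1))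
      (deriv Real.smoothTransition (U x ^ 2 - 1) • ((2 * U x) • U')) x :=
    HasDerivAt.comp_hasFDerivAt (h₂ := Real.smoothTransition) x
      ((Real.smoothTransition.contDiff (n := 1)).differentiable one_ne_zero _).hasDerivAt
      (hsq.sub_const 1)
  have hL := (hsq.const_add 1).log hW
  have hG := ((hg.comp_hasFDerivAt x hP).mul_const (2⁻¹ : ℝ)).mul hL
  have hfun : (fun y => powCut N (U y) (P y)) =
      (fun y => Real.smoothTransition (U y ^ 2 - 1)) * fun y =>
        Real.exp (((fun y => (chainExp N ∘ P) y * 2⁻¹) * fun y => Real.log (1 + U y ^ 2)) y) := by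
    funext y
    simp [powCut, div_eq_mul_inv]
  rw [hfun]
  refine (hS.mul hG.exp).congr_fderiv ?_
  ext v
  simp [powCutDerivFst, powCutDerivSnd, div_eq_mul_inv]
  ring

/-- Also used on ℝ × ℝᴺ, where a scaling parameter becomes an additional variable. -/
lemma contDiff_powCut_comp {N : ℕ} {E : Type*} [NormedAddCommGroup E] [NormedSpace ℝ E]
    {U P : E → ℝ} (hU : ContDiff ℝ 1 U) (hP : ContDiff ℝ 1 P) (hx : ∀ x, P x < N) :
    ContDiff ℝ 1 (fun y => powCut N (U y) (P y)) := by
  unfold powCut chainExp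
  refine ContDiff.mul (Real.smoothTransition.contDiff.comp (by fun_prop)) (ContDiff.exp ?_)
  refine ContDiff.mul (ContDiff.div_const (ContDiff.div (by fun_prop) (by fun_prop) ?_) _)
    (ContDiff.log (by fun_prop) ?_)
  · intro x
    have := hx x
    linarith
  · intro x
    positivity

/-- Young's inequality for the derivatives of `powCut`, with critical remainder. -/
lemma powCut_deriv_le {N : ℕ} (hN : 2 ≤ N) {pp : ℝ} (hpp1 : 1 < pp) (hpp : pp < N) :
    ∃ C : ℝ, 0 < C ∧ ∀ t s D : ℝ, 1 < s → s ≤ pp → 0 ≤ D →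
      |powCutDerivFst N t s| * D ≤
        C * (powCut N t s ^ ((N : ℝ) / (N - 1)) + |t| ^ s + D ^ s) ∧
      |powCutDerivSnd N t s| ≤
        C * (powCut N t s ^ ((N : ℝ) / (N - 1)) + |t| ^ s) := by
  obtain ⟨c, hc0, hc⟩ := exists_deriv_smoothTransition_le
  have hN2 : (2 : ℝ) ≤ N := by exact_mod_cast hN
  have hNpp : 0 < (N : ℝ) - pp := by linarith
  -- Constants uniform in s ≤ pp: Γ dominates every critical exponent N s/(N - s), and G dominates
  -- half the derivative of `chainExp` in s.
  obtain ⟨Γ, hΓ⟩ : ∃ z : ℝ, z = N * pp / (N - pp) := ⟨_, rfl⟩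
  have hΓ0 : 0 < Γ := by rw [hΓ]; positivity
  obtain ⟨G, hG⟩ : ∃ z : ℝ, z = N ^ 2 / (N - pp) ^ 2 := ⟨_, rfl⟩
  have hG0 : 0 < G := by rw [hG]; positivity
  obtain ⟨A, hA⟩ : ∃ z : ℝ, z = (6 * c + Γ) * (3 ^ Γ + 1) := ⟨_, rfl⟩
  obtain ⟨B, hB⟩ : ∃ z : ℝ, z = 2 * N * G * 3 ^ Γ := ⟨_, rfl⟩
  have hA0 : 0 < A := by rw [hA]; positivity
  have hB0 : 0 < B := by rw [hB]; positivity
  refine ⟨A + B, by positivity, fun t s D hs1 hspp hD => ?_⟩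
  have hΦ0 := powCut_nonneg N t s
  obtain ⟨n', hn'⟩ : ∃ z : ℝ, z = (N : ℝ) / (N - 1) := ⟨_, rfl⟩
  rw [← hn']
  have hN1 : 0 < (N : ℝ) - 1 := by linarith
  have hNs : 0 < (N : ℝ) - s := by linarith
  rcases le_or_gt (t ^ 2) 1 with ht | ht
  · have h0 : t ^ 2 - 1 ≤ 0 := by linarith
    have e1 : powCutDerivFst N t s = 0 := by
      simp [powCutDerivFst, deriv_smoothTransition_eq_zero (Or.inl h0),
        Real.smoothTransition.zero_of_nonpos h0]
    have e2 : powCutDerivSnd N t s = 0 := by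
      simp [powCutDerivSnd, Real.smoothTransition.zero_of_nonpos h0]
    rw [e1, e2, abs_zero, zero_mul]
    constructor <;> positivity
  obtain ⟨W, hW⟩ : ∃ z : ℝ, z = 1 + t ^ 2 := ⟨_, rfl⟩
  have hW1 : 1 ≤ W := by rw [hW]; linarith
  have hW0 : 0 < W := by linarith
  obtain ⟨γ, hγ⟩ : ∃ z : ℝ, z = chainExp N s := ⟨_, rfl⟩
  have hγe : γ = s * (N - 1) / (N - s) := hγ
  obtain ⟨ps, hps⟩ : ∃ z : ℝ, z = N * s / (N - s) := ⟨_, rfl⟩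
  have hγps : γ * n' = ps := by
    rw [hγe, hn', hps]
    field_simp
  have hpsΓ : ps ≤ Γ := by
    rw [hps, hΓ]
    gcongr
  have hps0 : 0 < ps := by rw [hps]; positivity
  have hγ0 : 0 < γ := by rw [hγe]; positivity
  -- The gap between γ and the critical exponent ps is s/(N - s) ≥ 1/N. It pays for the logarithm in
  -- the s-derivative, through log W ≤ 2N W^{1/(2N)}.
  have hdiff : γ + 1 / N ≤ ps := by
    have : ps - γ = s / (N - s) := by
      rw [hγe, hps]; field_simp; ring
    have h2 : 1 / (N : ℝ) ≤ s / (N - s) := by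
      rw [div_le_div_iff₀ (by linarith) hNs, one_mul]
      exact (sub_le_self _ (by linarith)).trans (le_mul_of_one_le_left (by linarith) hs1.le)
    linarith
  have hγΓ : γ ≤ Γ := by
    have : 0 ≤ 1 / (N : ℝ) := by positivity
    linarith
  obtain ⟨E, hE⟩ : ∃ z : ℝ, z = Real.exp (γ / 2 * Real.log W) := ⟨_, rfl⟩
  have hE0 : 0 < E := hE ▸ Real.exp_pos _
  have hEW : E = W ^ (γ / 2) := by
    rw [hE, Real.rpow_def_of_pos hW0, mul_comm]
  obtain ⟨σ, hσ⟩ : ∃ z : ℝ, z = Real.smoothTransition (t ^ 2 - 1) := ⟨_, rfl⟩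
  have hσ0 : 0 ≤ σ := hσ ▸ Real.smoothTransition.nonneg _
  have hσ1 : σ ≤ 1 := hσ ▸ Real.smoothTransition.le_one _
  obtain ⟨Φ, hΦ⟩ : ∃ z : ℝ, z = powCut N t s := ⟨_, rfl⟩
  have hΦe : Φ = σ * E := by rw [hΦ, hσ, hE, hγ, hW, powCut]
  rw [← hΦ] at hΦ0 ⊢
  have htabs : 1 ≤ |t| := by
    exact (one_le_sq_iff_one_le_abs t).1 ht.le
  -- For t² > 2 the cutoff equals 1 and Φ^{n'} is exactly W^{ps/2}. In the transition zone 1 < t² ≤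
  -- 2 one has W ≤ 3, and |t|^s ≥ 1 absorbs the constant.
  have hQ : W ^ (ps / 2) ≤ 3 ^ Γ * (Φ ^ n' + |t| ^ s) := by
    have h3 : (1 : ℝ) ≤ 3 ^ Γ := Real.one_le_rpow (by norm_num) hΓ0.le
    have hts : 1 ≤ |t| ^ s := Real.one_le_rpow htabs (by linarith)
    rcases le_or_gt (t ^ 2) 2 with h2 | h2
    · have : W ^ (ps / 2) ≤ 3 ^ Γ := by
        calc W ^ (ps / 2) ≤ 3 ^ (ps / 2) :=
              Real.rpow_le_rpow hW0.le (by rw [hW]; linarith) (by positivity)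
          _ ≤ 3 ^ Γ := Real.rpow_le_rpow_of_exponent_le (by norm_num) (by linarith)
      have h4 : 0 ≤ Φ ^ n' := Real.rpow_nonneg hΦ0 _
      exact this.trans (le_mul_of_one_le_right (by positivity) (by linarith))
    · have e1 : σ = 1 := hσ ▸ Real.smoothTransition.one_of_one_le (by linarith)
      have e2 : Φ ^ n' = W ^ (ps / 2) := by
        rw [hΦe, e1, one_mul, hEW, ← Real.rpow_mul hW0.le, ← hγps]
        ring_nf
      rw [e2]
      have : 0 ≤ W ^ (ps / 2) := by positivity
      exact le_trans (by linarith) (le_mul_of_one_le_left (by linarith) h3)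
  have hE1 : E = W ^ ((1 : ℝ) / 2) * W ^ ((γ - 1) / 2) := by
    rw [hEW, ← Real.rpow_add hW0]; congr 1; ring
  have htW : |t| ≤ W ^ ((1 : ℝ) / 2) := by
    rw [← Real.sqrt_eq_rpow]
    exact Real.abs_le_sqrt (by rw [hW]; linarith)
  have hR0 : 0 < W ^ ((γ - 1) / 2) := by positivity
  -- Of E = W^{1/2} W^{(γ-1)/2}, the half power is absorbed by the bracket: the cutoff derivative
  -- lives on t² < 2, where |t| ≤ 3/2 and W^{1/2} ≤ 2 give 6c, and the other term gains |t|
  -- W^{1/2}/W ≤ 1.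
  have hfst : |powCutDerivFst N t s| ≤ (6 * c + Γ) * W ^ ((γ - 1) / 2) := by
    have h1 : |deriv Real.smoothTransition (t ^ 2 - 1) * (2 * t)| * W ^ ((1 : ℝ) / 2) ≤ 6 * c := by
      rcases le_or_gt 2 (t ^ 2) with h2 | h2
      · rw [deriv_smoothTransition_eq_zero (Or.inr (by linarith))]
        simp [hc0.le]
      · have hW2 : W ^ ((1 : ℝ) / 2) ≤ 2 := by
          rw [← Real.sqrt_eq_rpow, Real.sqrt_le_left (by norm_num)]
          rw [hW]; linarith
        have ht2 : |t| ≤ 3 / 2 := by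
          exact abs_le_of_sq_le_sq' (by linarith) (by norm_num) |> abs_le.2
        rw [abs_mul, abs_mul, abs_two]
        calc |deriv Real.smoothTransition (t ^ 2 - 1)| * (2 * |t|) * W ^ ((1 : ℝ) / 2)
            ≤ c * (2 * (3 / 2)) * 2 := by
              gcongr
              exact hc _
          _ = 6 * c := by ring
    have h2 : |σ * (γ / 2 * (2 * t / W))| * W ^ ((1 : ℝ) / 2) ≤ Γ := by
      rw [abs_mul, abs_mul, abs_div (2 * t), abs_mul 2, abs_two, abs_of_nonneg hσ0,
        abs_of_nonneg (show 0 ≤ γ / 2 by positivity), abs_of_pos hW0]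
      have h3 : |t| * W ^ ((1 : ℝ) / 2) ≤ W := by
        calc |t| * W ^ ((1 : ℝ) / 2) ≤ W ^ ((1 : ℝ) / 2) * W ^ ((1 : ℝ) / 2) := by gcongr
          _ = W := by rw [← Real.rpow_add hW0]; norm_num
      calc σ * (γ / 2 * (2 * |t| / W)) * W ^ ((1 : ℝ) / 2)
          = σ * γ * ((|t| * W ^ ((1 : ℝ) / 2)) / W) := by ring
        _ ≤ 1 * Γ * 1 := by
            gcongr
            exact (div_le_one hW0).2 h3
        _ = Γ := by ring
    have : powCutDerivFst N t s = (deriv Real.smoothTransition (t ^ 2 - 1) * (2 * t) +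
        σ * (γ / 2 * (2 * t / W))) * E := by
      rw [hσ, hE, hγ, hW, powCutDerivFst]
    rw [this, abs_mul, abs_of_pos hE0, hE1, ← mul_assoc]
    refine mul_le_mul_of_nonneg_right ?_ hR0.le
    refine (mul_le_mul_of_nonneg_right (abs_add_le _ _) (by positivity)).trans ?_
    rw [add_mul]
    linarith
  -- The choice of γ pays off here: γ - 1 = N(s-1)/(N-s), so the Young exponent s/(s-1) turns
  -- W^{(γ-1)/2} into the critical power W^{ps/2}.
  have hyoung : W ^ ((γ - 1) / 2) * D ≤ W ^ (ps / 2) + D ^ s := by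
    have hs0 : 0 < s - 1 := by linarith
    have hconj : (s / (s - 1)).HolderConjugate s := by
      rw [Real.holderConjugate_iff]
      refine ⟨by rw [one_lt_div hs0]; linarith, ?_⟩
      field_simp
      ring
    have := Real.young_inequality_of_nonneg hR0.le hD hconj
    have e1 : (W ^ ((γ - 1) / 2)) ^ (s / (s - 1)) = W ^ (ps / 2) := by
      rw [← Real.rpow_mul hW0.le]
      congr 1
      have : γ - 1 = N * (s - 1) / (N - s) := by
        rw [hγe]; field_simp; ring
      rw [this, hps]
      field_simp
    rw [e1] at this
    have h1 : W ^ (ps / 2) / (s / (s - 1)) ≤ W ^ (ps / 2) :=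
      div_le_self (by positivity) hconj.lt.le
    have h2 : D ^ s / s ≤ D ^ s := div_le_self (by positivity) hs1.le
    linarith
  have hsnd : |powCutDerivSnd N t s| ≤ 2 * N * G * W ^ (ps / 2) := by
    have hlog : Real.log W ≤ 2 * N * W ^ (1 / (2 * N) : ℝ) := by
      have := Real.log_le_rpow_div hW0.le (show (0 : ℝ) < 1 / (2 * N) by positivity)
      calc _ ≤ _ := this
        _ = _ := by field_simp
    have hlog0 : 0 ≤ Real.log W := Real.log_nonneg hW1
    have hGs : N * (N - 1) / (N - s) ^ 2 / 2 ≤ G := by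
      rw [hG]
      have : (N : ℝ) * (N - 1) / (N - s) ^ 2 ≤ N ^ 2 / (N - pp) ^ 2 := by
        rw [sq (N : ℝ)]
        gcongr
        linarith
      have h0 : 0 ≤ (N : ℝ) * (N - 1) / (N - s) ^ 2 := by positivity
      linarith
    have : powCutDerivSnd N t s = σ * (N * (N - 1) / (N - s) ^ 2 / 2 * Real.log W) * E := by
      rw [hσ, hE, hγ, hW, powCutDerivSnd]
    rw [this, abs_of_nonneg (by positivity)]
    calc σ * (N * (N - 1) / (N - s) ^ 2 / 2 * Real.log W) * E
        ≤ 1 * (G * (2 * N * W ^ (1 / (2 * N) : ℝ))) * E := by gcongr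
      _ = 2 * N * G * (W ^ (γ / 2) * W ^ (1 / (2 * N) : ℝ)) := by rw [hEW]; ring
      _ ≤ 2 * N * G * W ^ (ps / 2) := by
          rw [← Real.rpow_add hW0]
          gcongr
          have : (1 : ℝ) / (2 * N) = 1 / N / 2 := by field_simp
          linarith
  have hz : 0 ≤ Φ ^ n' + |t| ^ s := by positivity
  have hDs : 0 ≤ D ^ s := by positivity
  constructor
  · calc |powCutDerivFst N t s| * D ≤ (6 * c + Γ) * W ^ ((γ - 1) / 2) * D := by gcongr
      _ = (6 * c + Γ) * (W ^ ((γ - 1) / 2) * D) := by ring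
      _ ≤ (6 * c + Γ) * (3 ^ Γ * (Φ ^ n' + |t| ^ s) + D ^ s) := by
          gcongr
          linarith
      _ ≤ (6 * c + Γ) * ((3 ^ Γ + 1) * (Φ ^ n' + |t| ^ s + D ^ s)) := by
          gcongr
          have h3 : (0 : ℝ) ≤ 3 ^ Γ := by positivity
          rw [add_mul, mul_add ((3 : ℝ) ^ Γ)]
          have := mul_nonneg h3 hDs
          linarith
      _ = A * (Φ ^ n' + |t| ^ s + D ^ s) := by rw [hA]; ring
      _ ≤ (A + B) * (Φ ^ n' + |t| ^ s + D ^ s) := by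
          gcongr
          linarith
  · calc |powCutDerivSnd N t s| ≤ 2 * N * G * (3 ^ Γ * (Φ ^ n' + |t| ^ s)) := by
          refine hsnd.trans ?_
          gcongr
      _ = B * (Φ ^ n' + |t| ^ s) := by rw [hB]; ring
      _ ≤ (A + B) * (Φ ^ n' + |t| ^ s) := by
          gcongr
          linarith

/-! ### Critical modular estimate for smooth functions and smooth exponents -/

section VariableExponentModular

variable {X : Type*} [TopologicalSpace X]

lemma continuous_norm_rpow {F : Type*} [NormedAddCommGroup F] {f : X → F} {P : X → ℝ}
    (hf : Continuous f) (hP : Continuous P) (hpos : ∀ x, 0 < P x) :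
    Continuous fun x => ‖f x‖ ^ P x :=
  hf.norm.rpow hP fun x => Or.inr (hpos x)

lemma hasCompactSupport_norm_rpow {F : Type*} [NormedAddCommGroup F] {f : X → F} {P : X → ℝ}
    (hf : HasCompactSupport f) (hpos : ∀ x, 0 < P x) :
    HasCompactSupport fun x => ‖f x‖ ^ P x := by
  refine hf.mono fun x hx => ?_
  rw [Function.mem_support] at hx ⊢
  contrapose! hx
  rw [hx, norm_zero, Real.zero_rpow (hpos x).ne']

end VariableExponentModular

lemma powCut_rpow_zero {N : ℕ} {n s : ℝ} (hn : 0 < n) : powCut N 0 s ^ n = 0 := by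
  rw [powCut_zero, Real.zero_rpow hn.ne']

/-- The Gagliardo-Nirenberg-Sobolev inequality for `powCut N U P`, where `P` is a variable
exponent. -/
lemma powCut_gagliardo_nirenberg {N : ℕ} (hN : 2 ≤ N) {pp K : ℝ} (hpp1 : 1 < pp) (hpp : pp < N)
    (hK : 0 ≤ K) :
    ∃ C : ℝ, 0 < C ∧ ∀ P U : RN N → ℝ, ContDiff ℝ 1 P → (∀ x, 1 < P x) → (∀ x, P x ≤ pp) →
      (∀ x, ‖fderiv ℝ P x‖ ≤ K) → ContDiff ℝ 1 U → HasCompactSupport U →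
      (∫ x, powCut N (U x) (P x) ^ ((N : ℝ) / (N - 1))) ^ (1 / ((N : ℝ) / (N - 1))) ≤
        C * ((∫ x, powCut N (U x) (P x) ^ ((N : ℝ) / (N - 1))) +
          ((∫ x, ‖U x‖ ^ P x) + ∫ x, ‖fderiv ℝ U x‖ ^ P x)) := by
  obtain ⟨C₁, hC₁, hbd⟩ := powCut_deriv_le hN hpp1 hpp
  have hN2 : (2 : ℝ) ≤ N := by exact_mod_cast hN
  have hN1 : 0 < (N : ℝ) - 1 := by linarith
  obtain ⟨n, hn⟩ : ∃ z : ℝ, z = (N : ℝ) / (N - 1) := ⟨_, rfl⟩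
  simp only [← hn] at hbd ⊢
  have hn0 : 0 < n := by rw [hn]; positivity
  have hconj : NNReal.HolderConjugate (Module.finrank ℝ (RN N) : NNReal) n.toNNReal := by
    rw [NNReal.holderConjugate_iff, finrank_euclideanSpace_fin]
    refine ⟨by exact_mod_cast (show 1 < N by omega), ?_⟩
    rw [← NNReal.coe_inj]
    push_cast
    rw [Real.coe_toNNReal _ hn0.le, hn]
    field_simp
    ring
  set c := eLpNormLESNormFDerivOneConst (volume : Measure (RN N)) (n.toNNReal : ℝ) with hc
  -- The factor 1 + K accounts for ∇U and for ∇P, the latter bounded by K; c + 1 replaces c to keep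
  -- the constant positive.
  refine ⟨(c + 1) * (C₁ * (1 + K)), by positivity, ?_⟩
  intro P U hP hP1 hPpp hPK hU hUc
  have hP0 : ∀ x, 0 < P x := fun x => by linarith [hP1 x]
  set v : RN N → ℝ := fun x => powCut N (U x) (P x) with hv
  have hvC : ContDiff ℝ 1 v := contDiff_powCut_comp hU hP fun x => (hPpp x).trans_lt hpp
  have hv0 : ∀ x, 0 ≤ v x := fun x => powCut_nonneg _ _ _
  have hvc : HasCompactSupport v := by
    refine hUc.mono fun x hx => ?_
    rw [Function.mem_support] at hx ⊢
    contrapose! hx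
    rw [hv]
    simp only [hx, powCut_zero]
  have hI1 : Integrable fun x => v x ^ n := by
    refine Continuous.integrable_of_hasCompactSupport
      (hvC.continuous.rpow_const fun x => Or.inr hn0.le) (hvc.mono fun x hx => ?_)
    rw [Function.mem_support] at hx ⊢
    contrapose! hx
    rw [hx, Real.zero_rpow hn0.ne']
  have hI2 : Integrable fun x => ‖U x‖ ^ P x :=
    (continuous_norm_rpow hU.continuous hP.continuous hP0).integrable_of_hasCompactSupport
      (hasCompactSupport_norm_rpow hUc hP0)
  have hI3 : Integrable fun x => ‖fderiv ℝ U x‖ ^ P x :=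
    (continuous_norm_rpow (hU.continuous_fderiv one_ne_zero) hP.continuous
      hP0).integrable_of_hasCompactSupport (hasCompactSupport_norm_rpow (hUc.fderiv ℝ) hP0)
  have hfd : ∀ x, ‖fderiv ℝ v x‖ ≤
      C₁ * (1 + K) * (v x ^ n + (‖U x‖ ^ P x + ‖fderiv ℝ U x‖ ^ P x)) := by
    intro x
    have h1 := (hasFDerivAt_powCut_comp (N := N)
      (hU.differentiable one_ne_zero x).hasFDerivAt (hP.differentiable one_ne_zero x).hasFDerivAt
      ((hPpp x).trans_lt hpp).ne).fderiv
    have h2 := hbd (U x) (P x) ‖fderiv ℝ U x‖ (hP1 x) (hPpp x) (norm_nonneg _)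
    have e : ‖U x‖ = |U x| := rfl
    have hz1 : 0 ≤ v x ^ n := Real.rpow_nonneg (hv0 x) _
    have hz2 : 0 ≤ |U x| ^ P x := by positivity
    have hz3 : 0 ≤ ‖fderiv ℝ U x‖ ^ P x := by positivity
    rw [hv, h1, e]
    calc _ ≤ |powCutDerivFst N (U x) (P x)| * ‖fderiv ℝ U x‖ +
          |powCutDerivSnd N (U x) (P x)| * ‖fderiv ℝ P x‖ := by
          refine (norm_add_le _ _).trans (le_of_eq ?_)
          rw [norm_smul, norm_smul, Real.norm_eq_abs, Real.norm_eq_abs]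
      _ ≤ C₁ * (v x ^ n + |U x| ^ P x + ‖fderiv ℝ U x‖ ^ P x) +
          C₁ * (v x ^ n + |U x| ^ P x) * K := by
          refine add_le_add h2.1 (mul_le_mul h2.2 (hPK x) (norm_nonneg _) ?_)
          exact mul_nonneg hC₁.le (add_nonneg hz1 hz2)
      _ ≤ C₁ * (v x ^ n + |U x| ^ P x + ‖fderiv ℝ U x‖ ^ P x) +
          C₁ * (v x ^ n + |U x| ^ P x + ‖fderiv ℝ U x‖ ^ P x) * K :=
          add_le_add le_rfl (mul_le_mul_of_nonneg_right
            (mul_le_mul_of_nonneg_left (by linarith) hC₁.le) hK)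
      _ = _ := by ring
  have hgns := eLpNorm_le_eLpNorm_fderiv_one (volume : Measure (RN N)) hvC hvc hconj
  have hX0 : 0 ≤ ∫ x, v x ^ n := integral_nonneg fun x => Real.rpow_nonneg (hv0 x) _
  have hY0 : 0 ≤ (∫ x, ‖U x‖ ^ P x) + ∫ x, ‖fderiv ℝ U x‖ ^ P x :=
    add_nonneg (integral_nonneg fun x => by positivity) (integral_nonneg fun x => by positivity)
  have hleft : eLpNorm v (n.toNNReal : ENNReal) volume =
      ENNReal.ofReal ((∫ x, v x ^ n) ^ (1 / n)) := by
    rw [eLpNorm_nnreal_eq_lintegral (by simpa using hn0), Real.coe_toNNReal _ hn0.le,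
      ← ENNReal.ofReal_rpow_of_nonneg hX0 (by positivity),
      ofReal_integral_eq_lintegral_ofReal hI1
        (Filter.Eventually.of_forall fun x => Real.rpow_nonneg (hv0 x) _)]
    congr 1
    refine lintegral_congr fun x => ?_
    rw [Real.enorm_of_nonneg (hv0 x), ENNReal.ofReal_rpow_of_nonneg (hv0 x) hn0.le]
  have hright : eLpNorm (fderiv ℝ v) 1 volume ≤ ENNReal.ofReal (C₁ * (1 + K) *
      ((∫ x, v x ^ n) + ((∫ x, ‖U x‖ ^ P x) + ∫ x, ‖fderiv ℝ U x‖ ^ P x))) := by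
    have hI23 : Integrable fun x => ‖U x‖ ^ P x + ‖fderiv ℝ U x‖ ^ P x := hI2.add hI3
    have hI : Integrable fun x =>
        C₁ * (1 + K) * (v x ^ n + (‖U x‖ ^ P x + ‖fderiv ℝ U x‖ ^ P x)) :=
      (hI1.add hI23).const_mul _
    have hz : ∀ x, 0 ≤ C₁ * (1 + K) * (v x ^ n + (‖U x‖ ^ P x + ‖fderiv ℝ U x‖ ^ P x)) :=
      fun x => (norm_nonneg _).trans (hfd x)
    rw [eLpNorm_one_eq_lintegral_enorm, ← integral_add hI2 hI3, ← integral_add hI1 hI23,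
      ← integral_const_mul, ofReal_integral_eq_lintegral_ofReal hI (Filter.Eventually.of_forall hz)]
    refine lintegral_mono fun x => ?_
    rw [← ofReal_norm]
    exact ENNReal.ofReal_le_ofReal (hfd x)
  rw [hleft] at hgns
  have hfin := hgns.trans (mul_le_mul_right hright _)
  rw [← hc, ← ENNReal.ofReal_coe_nnreal, ← ENNReal.ofReal_mul (by positivity),
    ENNReal.ofReal_le_ofReal_iff (by positivity)] at hfin
  refine hfin.trans ?_
  rw [mul_assoc _ (C₁ * (1 + K))]
  gcongr
  linarith

/-- Since `powCut` vanishes at t = 0, all the integrands live on the fixed compact set `tsupport U`,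
so joint continuity suffices. This feeds the intermediate value argument in τ. -/
lemma continuous_integral_powCut_smul {N : ℕ} {n pp : ℝ} (hn : 0 < n) (hpp : pp < N)
    {P U : RN N → ℝ} (hP : ContDiff ℝ 1 P) (hPpp : ∀ x, P x ≤ pp) (hU : ContDiff ℝ 1 U)
    (hUc : HasCompactSupport U) :
    Continuous fun τ : ℝ => ∫ x, powCut N (τ * U x) (P x) ^ n := by
  have h1 : ∀ τ : ℝ, ∫ x, powCut N (τ * U x) (P x) ^ n =
      ∫ x in tsupport U, powCut N (τ * U x) (P x) ^ n := by
    intro τ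
    refine (setIntegral_eq_integral_of_forall_compl_eq_zero fun x hx => ?_).symm
    rw [image_eq_zero_of_notMem_tsupport hx, mul_zero, powCut_rpow_zero hn]
  simp only [h1]
  refine continuous_parametric_integral_of_continuous ?_ hUc
  refine Continuous.rpow_const ?_ fun x => Or.inr hn.le
  have : ContDiff ℝ 1 fun z : ℝ × RN N => powCut N (z.1 * U z.2) (P z.2) :=
    contDiff_powCut_comp (by fun_prop) (by fun_prop) fun z => (hPpp z.2).trans_lt hpp
  exact this.continuous

/-- If the modular of `U` and of its gradient is small, then so is the critical modular of `U`. -/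
lemma integral_powCut_le_of_modular_le {N : ℕ} (hN : 2 ≤ N) {pp K : ℝ} (hpp1 : 1 < pp)
    (hpp : pp < N) (hK : 0 ≤ K) :
    ∃ a : ℝ, 0 < a ∧ ∀ P U : RN N → ℝ, ContDiff ℝ 1 P → (∀ x, 1 < P x) → (∀ x, P x ≤ pp) →
      (∀ x, ‖fderiv ℝ P x‖ ≤ K) → ContDiff ℝ 1 U → HasCompactSupport U →
      (∫ x, ‖U x‖ ^ P x) + (∫ x, ‖fderiv ℝ U x‖ ^ P x) ≤ a →
      ∫ x, powCut N (U x) (P x) ^ ((N : ℝ) / (N - 1)) ≤ a := by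
  obtain ⟨C, hC, hgns⟩ := powCut_gagliardo_nirenberg hN hpp1 hpp hK
  have hN2 : (2 : ℝ) ≤ N := by exact_mod_cast hN
  have hN1 : 0 < (N : ℝ) - 1 := by linarith
  obtain ⟨n, hn⟩ : ∃ z : ℝ, z = (N : ℝ) / (N - 1) := ⟨_, rfl⟩
  simp only [← hn] at hgns ⊢
  have hn0 : 0 < n := by rw [hn]; positivity
  -- As 1/n = 1 - 1/N, this a satisfies a^{1/n} = 4C a > C(a + a). The Sobolev inequality therefore
  -- forbids a critical modular equal to a when the modular of U and its gradient is at most a.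
  set a : ℝ := (1 / (4 * C)) ^ (N : ℝ) with ha
  have ha0 : 0 < a := by positivity
  have hagap : C * (a + a) < a ^ (1 / n) := by
    have h1 : a ^ (1 / n) = a * (4 * C) := by
      have h2 : (1 : ℝ) / n = 1 + -1 / N := by
        rw [hn]; field_simp; ring
      rw [h2, Real.rpow_add ha0, Real.rpow_one, ha, ← Real.rpow_mul (by positivity)]
      congr 1
      rw [mul_div_cancel₀ _ (by positivity), Real.rpow_neg_one]
      simp
    rw [h1]
    nlinarith [mul_pos ha0 hC]
  refine ⟨a, ha0, fun P U hP hP1 hPpp hPK hU hUc hmod => ?_⟩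
  have hP0 : ∀ x, 0 < P x := fun x => by linarith [hP1 x]
  -- Continuity method: the critical modular of τU moves from 0 at τ = 0 to above a at τ = 1, so it
  -- hits the forbidden value a, while the ordinary modular of τU stays at most a.
  by_contra! hlt
  have hcont := continuous_integral_powCut_smul hn0 hpp hP hPpp hU hUc
  have hmem : a ∈ Set.Icc (∫ x, powCut N ((0 : ℝ) * U x) (P x) ^ n)
      (∫ x, powCut N ((1 : ℝ) * U x) (P x) ^ n) := by
    constructor
    · simp only [zero_mul, powCut_rpow_zero hn0, integral_zero]
      exact ha0.le
    · simp only [one_mul]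
      exact hlt.le
  obtain ⟨τ, ⟨hτ0, hτ1⟩, hτ⟩ := intermediate_value_Icc zero_le_one hcont.continuousOn hmem
  have hg := hgns P (fun x => τ * U x) hP hP1 hPpp hPK (contDiff_const.mul hU) hUc.mul_left
  simp only at hτ
  rw [hτ] at hg
  have hpow : ∀ (x : RN N) (s : ℝ), 0 ≤ s → (τ * s) ^ P x ≤ s ^ P x := fun x s hs =>
    Real.rpow_le_rpow (by positivity) (mul_le_of_le_one_left hs hτ1) (hP0 x).le
  have hfd : ∀ x, fderiv ℝ (fun x => τ * U x) x = τ • fderiv ℝ U x := fun x =>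
    fderiv_const_mul (hU.differentiable one_ne_zero x) τ
  have hle : (∫ x, ‖τ * U x‖ ^ P x) + (∫ x, ‖fderiv ℝ (fun x => τ * U x) x‖ ^ P x) ≤ a := by
    refine le_trans (add_le_add ?_ ?_) hmod
    · refine integral_mono_of_nonneg (Filter.Eventually.of_forall fun x => by positivity)
        ((continuous_norm_rpow hU.continuous hP.continuous hP0).integrable_of_hasCompactSupport
          (hasCompactSupport_norm_rpow hUc hP0)) (Filter.Eventually.of_forall fun x => ?_)
      simp only [norm_mul, Real.norm_of_nonneg hτ0]
      exact hpow x _ (norm_nonneg _)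
    · refine integral_mono_of_nonneg (Filter.Eventually.of_forall fun x => by positivity)
        ((continuous_norm_rpow (hU.continuous_fderiv one_ne_zero) hP.continuous
          hP0).integrable_of_hasCompactSupport (hasCompactSupport_norm_rpow (hUc.fderiv ℝ) hP0))
        (Filter.Eventually.of_forall fun x => ?_)
      simp only [hfd, norm_smul, Real.norm_of_nonneg hτ0]
      exact hpow x _ (norm_nonneg _)
  have : C * (a + ((∫ x, ‖τ * U x‖ ^ P x) + ∫ x, ‖fderiv ℝ (fun x => τ * U x) x‖ ^ P x)) ≤
      C * (a + a) := by gcongr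
  linarith

/-! ### Mollification of functions, weak gradients and Lipschitz exponents -/

section Mollification

variable {N : ℕ} {F : Type*} [NormedAddCommGroup F] [NormedSpace ℝ F]

/-- Mollification of `G` by a normed bump function. -/
noncomputable def mollify (φ : ContDiffBump (0 : RN N)) (G : RN N → F) : RN N → F :=
  convolution (φ.normed volume) G (ContinuousLinearMap.lsmul ℝ ℝ) volume

lemma mollify_apply (φ : ContDiffBump (0 : RN N)) (G : RN N → F) (x : RN N) :
    mollify φ G x = ∫ y, φ.normed volume (x - y) • G y :=
  convolution_lsmul_swap

lemma mollify_apply' (φ : ContDiffBump (0 : RN N)) (G : RN N → F) (x : RN N) :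
    mollify φ G x = ∫ y, φ.normed volume y • G (x - y) :=
  convolution_lsmul

lemma contDiff_mollify (φ : ContDiffBump (0 : RN N)) {G : RN N → F}
    (hG : LocallyIntegrable G volume) : ContDiff ℝ 1 (mollify φ G) :=
  φ.hasCompactSupport_normed.contDiff_convolution_left _ φ.contDiff_normed hG

lemma integrable_normed_sub_smul (φ : ContDiffBump (0 : RN N)) {G : RN N → F}
    (hG : LocallyIntegrable G volume) (x : RN N) :
    Integrable fun y => φ.normed volume (x - y) • G y := by
  refine hG.integrable_smul_left_of_hasCompactSupport
    (φ.continuous_normed.comp (continuous_const.sub continuous_id)) ?_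
  exact φ.hasCompactSupport_normed.comp_homeomorph (Homeomorph.subLeft x)

lemma integrable_normed_smul_sub (φ : ContDiffBump (0 : RN N)) {G : RN N → F}
    (hG : LocallyIntegrable G volume) (x : RN N) :
    Integrable fun y => φ.normed volume y • G (x - y) := by
  have := (integrable_normed_sub_smul φ hG x).comp_sub_left x
  simpa using this

lemma integral_normed_sub (φ : ContDiffBump (0 : RN N)) (x : RN N) :
    ∫ y, φ.normed volume (x - y) = 1 := by
  rw [integral_sub_left_eq_self (φ.normed volume) volume x, φ.integral_normed]

lemma lintegral_normed_sub (φ : ContDiffBump (0 : RN N)) (x : RN N) :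
    ∫⁻ y, ENNReal.ofReal (φ.normed volume (x - y)) = 1 := by
  rw [← ofReal_integral_eq_lintegral_ofReal (φ.integrable_normed.comp_sub_left x)
    (Filter.Eventually.of_forall fun y => φ.nonneg_normed _), integral_normed_sub,
    ENNReal.ofReal_one]

lemma lintegral_normed_sub_right (φ : ContDiffBump (0 : RN N)) (y : RN N) :
    ∫⁻ x, ENNReal.ofReal (φ.normed volume (x - y)) = 1 := by
  rw [← lintegral_normed_sub φ y]
  refine lintegral_congr fun x => ?_
  rw [← neg_sub, φ.normed_neg]

lemma normed_eq_zero (φ : ContDiffBump (0 : RN N)) {z : RN N} (hz : φ.rOut ≤ ‖z‖) :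
    φ.normed volume z = 0 := by
  by_contra h
  have : z ∈ Function.support (φ.normed volume) := h
  rw [φ.support_normed_eq, mem_ball_zero_iff] at this
  linarith

lemma abs_mollify_sub_le (φ : ContDiffBump (0 : RN N)) {p : RN N → ℝ} {K : NNReal}
    (hp : LipschitzWith K p) (x : RN N) : |mollify φ p x - p x| ≤ K * φ.rOut := by
  refine φ.dist_normed_convolution_le hp.continuous.aestronglyMeasurable fun y hy => ?_
  refine (hp.dist_le_mul y x).trans ?_
  gcongr
  exact (Metric.mem_ball.1 hy).le

/-- An average of translates of a K-Lipschitz function is K-Lipschitz. Smoothing the exponent thus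
keeps the gradient bound, uniformly in the mollification radius. -/
lemma norm_fderiv_mollify_le_of_lipschitz (φ : ContDiffBump (0 : RN N)) {p : RN N → ℝ}
    {K : NNReal} (hp : LipschitzWith K p) (x : RN N) : ‖fderiv ℝ (mollify φ p) x‖ ≤ K := by
  refine norm_fderiv_le_of_lipschitz ℝ (LipschitzWith.of_dist_le_mul fun a b => ?_)
  have hloc : LocallyIntegrable p volume := hp.continuous.locallyIntegrable
  rw [mollify_apply', mollify_apply', dist_eq_norm,
    ← integral_sub (integrable_normed_smul_sub φ hloc a) (integrable_normed_smul_sub φ hloc b)]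
  calc _ ≤ ∫ y, φ.normed volume y * (K * dist a b) := by
        refine norm_integral_le_of_norm_le (φ.integrable_normed.mul_const _)
          (Filter.Eventually.of_forall fun y => ?_)
        rw [← smul_sub, norm_smul, Real.norm_of_nonneg (φ.nonneg_normed y)]
        refine mul_le_mul_of_nonneg_left ?_ (φ.nonneg_normed y)
        rw [← dist_eq_norm]
        refine (hp.dist_le_mul _ _).trans (le_of_eq ?_)
        rw [dist_sub_right]
    _ = K * dist a b := by
        rw [integral_mul_const, φ.integral_normed, one_mul]

/-- The derivative falls on the bump, and y ↦ φ(x - y) is an admissible test function; the sign from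
the reflection cancels the one in the weak gradient identity. -/
lemma fderiv_mollify_apply_single (φ : ContDiffBump (0 : RN N)) {u : RN N → ℝ} {g : RN N → RN N}
    (h : HasWeakGradient u g) (x : RN N) (i : Fin N) :
    fderiv ℝ (mollify φ u) x (EuclideanSpace.single i 1) = mollify φ g x i := by
  obtain ⟨hu, hg, hweak⟩ := h
  have hsm : ContDiff ℝ ∞ (φ.normed (volume : Measure (RN N))) := φ.contDiff_normed
  have hderiv := φ.hasCompactSupport_normed.hasFDerivAt_convolution_left
    (ContinuousLinearMap.lsmul ℝ ℝ) (hsm.of_le (by norm_cast)) hu x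
  have hψ : ContDiff ℝ ∞ fun y => φ.normed volume (x - y) := hsm.comp (by fun_prop)
  have hψc : HasCompactSupport fun y => φ.normed volume (x - y) :=
    φ.hasCompactSupport_normed.comp_homeomorph (Homeomorph.subLeft x)
  have hψd : ∀ y, fderiv ℝ (fun y => φ.normed volume (x - y)) y (EuclideanSpace.single i 1) =
      - fderiv ℝ (φ.normed volume) (x - y) (EuclideanSpace.single i 1) := by
    intro y
    have h1 : HasFDerivAt (fun y : RN N => x - y) (-ContinuousLinearMap.id ℝ (RN N)) y :=
      (hasFDerivAt_id y).const_sub x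
    have h2 : HasFDerivAt (fun y => φ.normed volume (x - y)) _ y :=
      (hsm.differentiable (by simp) (x - y)).hasFDerivAt.comp y h1
    rw [h2.fderiv]
    simp
  have hint : Integrable (fun y => (((ContinuousLinearMap.lsmul ℝ ℝ).precompL (RN N))
      (fderiv ℝ (φ.normed volume) (x - y))) (u y)) :=
    ((φ.hasCompactSupport_normed.fderiv ℝ).convolutionExists_left _
      (hsm.continuous_fderiv (by simp)) hu x).integrable_swap
  have e1 : fderiv ℝ (mollify φ u) x (EuclideanSpace.single i 1) =
      ∫ y, fderiv ℝ (φ.normed volume) (x - y) (EuclideanSpace.single i 1) * u y := by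
    rw [mollify, hderiv.fderiv, convolution_eq_swap,
      ContinuousLinearMap.integral_apply hint]
    rfl
  have e2 : mollify φ g x i = ∫ y, g y i * φ.normed volume (x - y) := by
    rw [mollify_apply]
    have := (EuclideanSpace.proj i : RN N →L[ℝ] ℝ).integral_comp_comm
      (integrable_normed_sub_smul φ hg x)
    refine Eq.trans this.symm ?_
    refine integral_congr_ae (Filter.Eventually.of_forall fun y => ?_)
    simp [mul_comm]
  have h3 := hweak _ hψ hψc i
  rw [e1, e2, ← neg_eq_iff_eq_neg.2 h3, ← integral_neg]
  refine integral_congr_ae (Filter.Eventually.of_forall fun y => ?_)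
  simp only [hψd]
  ring

/-- The derivative acts as the inner product with the mollified weak gradient, so Cauchy-Schwarz
applies. -/
lemma norm_fderiv_mollify_le (φ : ContDiffBump (0 : RN N)) {u : RN N → ℝ} {g : RN N → RN N}
    (h : HasWeakGradient u g) (x : RN N) : ‖fderiv ℝ (mollify φ u) x‖ ≤ ‖mollify φ g x‖ := by
  refine ContinuousLinearMap.opNorm_le_bound _ (norm_nonneg _) fun v => ?_
  have : fderiv ℝ (mollify φ u) x v = inner ℝ (mollify φ g x) v := by
    conv_lhs => rw [← (EuclideanSpace.basisFun (Fin N) ℝ).sum_repr v]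
    simp only [map_sum, map_smul, EuclideanSpace.basisFun_apply, EuclideanSpace.basisFun_repr,
      fderiv_mollify_apply_single φ h, PiLp.inner_apply]
    simp
  rw [this]
  exact norm_inner_le_norm _ _

/-- Jensen's inequality for mollifications. -/
lemma ofReal_norm_mollify_rpow_le (φ : ContDiffBump (0 : RN N)) {G : RN N → F}
    (hG : AEStronglyMeasurable G volume) {s : ℝ} (hs : 1 ≤ s) (x : RN N) :
    ENNReal.ofReal (‖mollify φ G x‖ ^ s) ≤
      ∫⁻ y, ENNReal.ofReal (φ.normed volume (x - y)) * ENNReal.ofReal (‖G y‖ ^ s) := by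
  have hs0 : 0 < s := by linarith
  have hφm : Measurable fun y => ENNReal.ofReal (φ.normed volume (x - y)) :=
    (φ.continuous_normed.comp (continuous_const.sub continuous_id)).measurable.ennreal_ofReal
  have hGm : AEMeasurable fun y => ENNReal.ofReal (‖G y‖ ^ s) :=
    (hG.norm.aemeasurable.pow_const s).ennreal_ofReal
  -- Writing φ = φ^{1-1/s} φ^{1/s} prepares Hölder with weights 1 - 1/s and 1/s. The first factor
  -- then contributes the unit mass of the bump, and s = 1 needs no separate treatment.
  have h1 : ENNReal.ofReal ‖mollify φ G x‖ ≤
      ∫⁻ y, ENNReal.ofReal (φ.normed volume (x - y)) ^ (1 - 1 / s) *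
        (ENNReal.ofReal (φ.normed volume (x - y)) * ENNReal.ofReal (‖G y‖ ^ s)) ^ (1 / s) := by
    rw [mollify_apply, ofReal_norm]
    refine (enorm_integral_le_lintegral_enorm _).trans (le_of_eq (lintegral_congr fun y => ?_))
    have hφ0 : 0 ≤ φ.normed volume (x - y) := φ.nonneg_normed _
    have hle : 0 ≤ 1 - 1 / s := by
      have := (div_le_one hs0).2 hs
      linarith
    have hinv : 0 ≤ 1 / s := by positivity
    rw [enorm_smul, Real.enorm_of_nonneg hφ0, ENNReal.mul_rpow_of_nonneg _ _ hinv, ← mul_assoc,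
      ← ENNReal.rpow_add_of_nonneg _ _ hle hinv, sub_add_cancel, ENNReal.rpow_one,
      ENNReal.ofReal_rpow_of_nonneg (by positivity) hinv, ← Real.rpow_mul (norm_nonneg _),
      mul_one_div_cancel hs0.ne', Real.rpow_one, ofReal_norm]
  have h2 := h1.trans (ENNReal.lintegral_mul_norm_pow_le hφm.aemeasurable
    (hφm.aemeasurable.mul hGm) (by have := (div_le_one hs0).2 hs; linarith)
      (by positivity : 0 ≤ 1 / s) (sub_add_cancel _ _))
  rw [lintegral_normed_sub, ENNReal.one_rpow, one_mul] at h2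
  calc ENNReal.ofReal (‖mollify φ G x‖ ^ s) = ENNReal.ofReal ‖mollify φ G x‖ ^ s :=
        (ENNReal.ofReal_rpow_of_nonneg (norm_nonneg _) hs0.le).symm
    _ ≤ _ := ENNReal.rpow_le_rpow h2 hs0.le
    _ = _ := by
        rw [← ENNReal.rpow_mul, one_div_mul_cancel hs0.ne', ENNReal.rpow_one]
        rfl

end Mollification

/-! ### Modulars under smoothing, and the approximating sequence -/

/-- Changing the exponent of `t ^ q` by at most `q - s` costs at most `q - s`. -/
lemma rpow_le_rpow_add_sub {t s q : ℝ} (ht : 0 ≤ t) (hs : 1 ≤ s) (hsq : s ≤ q) :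
    t ^ s ≤ t ^ q + (q - s) := by
  rcases le_or_gt 1 t with h1 | h1
  · have := Real.rpow_le_rpow_of_exponent_le h1 hsq
    linarith
  rcases ht.eq_or_lt with h0 | h0
  · rw [← h0, Real.zero_rpow (by linarith), Real.zero_rpow (by linarith)]
    linarith
  -- For 0 < t < 1, t log t ≥ t - 1 and t^s ≤ t give t^s log t ≥ -1. Linearising t^{q-s} ≥ 1 + (q-s)
  -- log t then loses at most q - s.
  have hlog : -1 ≤ t * Real.log t := by
    have := Real.one_sub_inv_le_log_of_pos h0
    have h2 : t * (1 - t⁻¹) = t - 1 := by field_simp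
    nlinarith
  have hts : t ^ s ≤ t := by
    simpa using Real.rpow_le_rpow_of_exponent_ge h0 h1.le hs
  have hts0 : 0 < t ^ s := by positivity
  have hexp : 1 + (q - s) * Real.log t ≤ t ^ (q - s) := by
    rw [Real.rpow_def_of_pos h0]
    have := Real.add_one_le_exp (Real.log t * (q - s))
    linarith
  have hlog0 : Real.log t ≤ 0 := Real.log_nonpos ht h1.le
  have hsl : -1 ≤ t ^ s * Real.log t := by nlinarith
  have hq : t ^ q = t ^ s * t ^ (q - s) := by
    rw [← Real.rpow_add h0]
    congr 1
    ring
  rw [hq]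
  have h3 : t ^ s * (1 + (q - s) * Real.log t) ≤ t ^ s * t ^ (q - s) := by gcongr
  nlinarith

/-- Version of `integral_powCut_le_of_modular_le` for lower integrals. -/
lemma lintegral_powCut_le_of_modular_le {N : ℕ} (hN : 2 ≤ N) {pp K : ℝ} (hpp1 : 1 < pp)
    (hpp : pp < N) (hK : 0 ≤ K) :
    ∃ a : ℝ, 0 < a ∧ ∀ P U : RN N → ℝ, ContDiff ℝ 1 P → (∀ x, 1 < P x) → (∀ x, P x ≤ pp) →
      (∀ x, ‖fderiv ℝ P x‖ ≤ K) → ContDiff ℝ 1 U → HasCompactSupport U →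
      ∫⁻ x, (ENNReal.ofReal (‖U x‖ ^ P x) + ENNReal.ofReal (‖fderiv ℝ U x‖ ^ P x)) ≤
        ENNReal.ofReal a →
      ∫⁻ x, ENNReal.ofReal (powCut N (U x) (P x) ^ ((N : ℝ) / (N - 1))) ≤ ENNReal.ofReal a := by
  obtain ⟨a, ha, h⟩ := integral_powCut_le_of_modular_le hN hpp1 hpp hK
  refine ⟨a, ha, fun P U hP hP1 hPpp hPK hU hUc hmod => ?_⟩
  have hP0 : ∀ x, 0 < P x := fun x => by linarith [hP1 x]
  have hN2 : (2 : ℝ) ≤ N := by exact_mod_cast hN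
  have hn0 : 0 < (N : ℝ) / (N - 1) := div_pos (by linarith) (by linarith)
  have hc2 := continuous_norm_rpow hU.continuous hP.continuous hP0
  have hI2 := hc2.integrable_of_hasCompactSupport (μ := volume)
      (hasCompactSupport_norm_rpow hUc hP0)
  have hI3 := (continuous_norm_rpow (hU.continuous_fderiv one_ne_zero) hP.continuous
      hP0).integrable_of_hasCompactSupport (μ := volume)
      (hasCompactSupport_norm_rpow (hUc.fderiv ℝ) hP0)
  have hI1 : Integrable fun x => powCut N (U x) (P x) ^ ((N : ℝ) / (N - 1)) := by
    refine Continuous.integrable_of_hasCompactSupport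
      ((contDiff_powCut_comp hU hP fun x => (hPpp x).trans_lt hpp).continuous.rpow_const
        fun x => Or.inr hn0.le) (hUc.mono fun x hx => ?_)
    rw [Function.mem_support] at hx ⊢
    contrapose! hx
    rw [hx, powCut_rpow_zero hn0]
  rw [← ofReal_integral_eq_lintegral_ofReal hI1
    (Filter.Eventually.of_forall fun x => Real.rpow_nonneg (powCut_nonneg _ _ _) _)]
  refine ENNReal.ofReal_le_ofReal (h P U hP hP1 hPpp hPK hU hUc ?_)
  rw [lintegral_add_left hc2.measurable.ennreal_ofReal,
    ← ofReal_integral_eq_lintegral_ofReal hI2 (Filter.Eventually.of_forall fun x => by positivity),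
    ← ofReal_integral_eq_lintegral_ofReal hI3 (Filter.Eventually.of_forall fun x => by positivity),
    ← ENNReal.ofReal_add (integral_nonneg fun x => by positivity)
      (integral_nonneg fun x => by positivity)] at hmod
  exact (ENNReal.ofReal_le_ofReal_iff ha.le).1 hmod

/-- Mollification almost decreases the modular, up to an error from the change of exponent. -/
lemma lintegral_mollify_rpow_le {N : ℕ} {F : Type*} [NormedAddCommGroup F] [NormedSpace ℝ F]
    (φ : ContDiffBump (0 : RN N)) {p P : RN N → ℝ} {G : RN N → F} {σ : ℝ}
    (hG : AEStronglyMeasurable G volume) (hp : Continuous p) (hP1 : ∀ x, 1 ≤ P x) (hσ : 0 ≤ σ)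
    (hPp : ∀ x y, ‖x - y‖ < φ.rOut → P x ≤ p y ∧ p y ≤ P x + σ) (S : Set (RN N)) :
    ∫⁻ x in S, ENNReal.ofReal (‖mollify φ G x‖ ^ P x) ≤
      (∫⁻ y, ENNReal.ofReal (‖G y‖ ^ p y)) + ENNReal.ofReal σ * volume S := by
  have hhm : AEMeasurable fun y => ENNReal.ofReal (‖G y‖ ^ p y) :=
    (hG.norm.aemeasurable.pow hp.aemeasurable).ennreal_ofReal
  have hφm : Measurable fun z : RN N × RN N => ENNReal.ofReal (φ.normed volume (z.1 - z.2)) :=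
    (φ.continuous_normed.comp (continuous_fst.sub continuous_snd)).measurable.ennreal_ofReal
  -- Jensen is applied with the exponent frozen at x. On the support of the bump, P x is then
  -- exchanged for p y at cost σ, and the unit mass of the bump leaves σ in total.
  have hpt : ∀ x, ENNReal.ofReal (‖mollify φ G x‖ ^ P x) ≤
      (∫⁻ y, ENNReal.ofReal (φ.normed volume (x - y)) * ENNReal.ofReal (‖G y‖ ^ p y)) +
        ENNReal.ofReal σ := by
    intro x
    have hφx : Measurable fun y => ENNReal.ofReal (φ.normed volume (x - y)) :=
      (φ.continuous_normed.comp (continuous_const.sub continuous_id)).measurable.ennreal_ofReal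
    refine (ofReal_norm_mollify_rpow_le φ hG (hP1 x) x).trans ?_
    calc _ ≤ ∫⁻ y, (ENNReal.ofReal (φ.normed volume (x - y)) * ENNReal.ofReal (‖G y‖ ^ p y) +
          ENNReal.ofReal (φ.normed volume (x - y)) * ENNReal.ofReal σ) := by
          refine lintegral_mono fun y => ?_
          rcases lt_or_ge ‖x - y‖ φ.rOut with h | h
          · rw [← mul_add, ← ENNReal.ofReal_add (by positivity) hσ]
            gcongr
            have h1 := hPp x y h
            have := rpow_le_rpow_add_sub (norm_nonneg (G y)) (hP1 x) h1.1
            linarith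
          · simp [normed_eq_zero φ h]
      _ = _ := by
          rw [lintegral_add_right _ (hφx.mul_const _), lintegral_mul_const _ hφx,
            lintegral_normed_sub, one_mul]
  calc _ ≤ ∫⁻ x in S, ((∫⁻ y, ENNReal.ofReal (φ.normed volume (x - y)) *
        ENNReal.ofReal (‖G y‖ ^ p y)) + ENNReal.ofReal σ) := lintegral_mono fun x => hpt x
    _ = (∫⁻ x in S, ∫⁻ y, ENNReal.ofReal (φ.normed volume (x - y)) *
        ENNReal.ofReal (‖G y‖ ^ p y)) + ENNReal.ofReal σ * volume S := by
        rw [lintegral_add_right _ measurable_const, setLIntegral_const]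
    _ ≤ (∫⁻ x, ∫⁻ y, ENNReal.ofReal (φ.normed volume (x - y)) *
        ENNReal.ofReal (‖G y‖ ^ p y)) + ENNReal.ofReal σ * volume S := by
        gcongr
        exact Measure.restrict_le_self
    _ = _ := by
        rw [lintegral_lintegral_swap (hφm.aemeasurable.mul hhm.comp_snd)]
        congr 1
        refine lintegral_congr fun y => ?_
        have hφy : Measurable fun x => ENNReal.ofReal (φ.normed volume (x - y)) :=
          (φ.continuous_normed.comp (continuous_id.sub continuous_const)).measurable.ennreal_ofReal
        rw [lintegral_mul_const _ hφy, lintegral_normed_sub_right, one_mul]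

/-- Smooth cutoff functions at scale `R ≥ 1` with uniformly bounded gradient. -/
lemma exists_cutoff (N : ℕ) :
    ∃ c : ℝ, 1 ≤ c ∧ ∀ R : ℝ, 1 ≤ R → ∃ η : RN N → ℝ, ContDiff ℝ 1 η ∧ (∀ x, 0 ≤ η x) ∧
      (∀ x, η x ≤ 1) ∧ (∀ x, ‖x‖ ≤ R → η x = 1) ∧
      Function.support η ⊆ Metric.closedBall 0 (2 * R) ∧ ∀ x, ‖fderiv ℝ η x‖ ≤ c := by
  let ψ : ContDiffBump (0 : RN N) := ⟨1, 2, one_pos, one_lt_two⟩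
  have hψ : ContDiff ℝ 1 ψ := ψ.contDiff
  obtain ⟨c, hc⟩ := (hψ.continuous_fderiv one_ne_zero).bounded_above_of_compact_support
    (ψ.hasCompactSupport.fderiv ℝ)
  refine ⟨max c 1, le_max_right _ _, fun R hR => ?_⟩
  have hR0 : 0 < R := by linarith
  have hn : ∀ x : RN N, ‖R⁻¹ • x‖ = ‖x‖ / R := fun x => by
    rw [norm_smul, norm_inv, Real.norm_of_nonneg hR0.le, inv_mul_eq_div]
  refine ⟨fun x => ψ (R⁻¹ • x), hψ.comp (by fun_prop), fun x => ψ.nonneg, fun x => ψ.le_one,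
    fun x hx => ?_, fun x hx => ?_, fun x => ?_⟩
  · refine ψ.one_of_mem_closedBall ?_
    rw [mem_closedBall_zero_iff, hn]
    exact (div_le_one hR0).2 hx
  · have : R⁻¹ • x ∈ Function.support ψ := hx
    rw [ψ.support_eq, mem_ball_zero_iff, hn, div_lt_iff₀ hR0] at this
    exact mem_closedBall_zero_iff.2 this.le
  · rw [fderiv_comp_smul, norm_smul, norm_inv, Real.norm_of_nonneg hR0.le]
    calc R⁻¹ * ‖fderiv ℝ ψ (R⁻¹ • x)‖ ≤ 1 * max c 1 := by
          gcongr
          · exact inv_le_one_of_one_le₀ hR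
          · exact (hc _).trans (le_max_left _ _)
      _ = _ := one_mul _

/-- Since P ≥ 1 and τ ≤ 1, τ^P ≤ τ, so the bound is linear in τ and a small τ brings it below any
threshold. The error occurs twice, for u and for g; the product rule with the cutoff produces 2c. -/
lemma lintegral_modular_cutoff_mollify_le {N : ℕ} (φ : ContDiffBump (0 : RN N))
    {p P u : RN N → ℝ} {g : RN N → RN N} {σ c R τ pp : ℝ} {η : RN N → ℝ}
    (hug : HasWeakGradient u g) (hp : Continuous p) (hP : Continuous P)
    (hP1 : ∀ x, 1 ≤ P x) (hPpp : ∀ x, P x ≤ pp)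
    (hσ : 0 ≤ σ) (hPp : ∀ x y, ‖x - y‖ < φ.rOut → P x ≤ p y ∧ p y ≤ P x + σ)
    (hc : 1 ≤ c) (hη : ContDiff ℝ 1 η) (hη0 : ∀ x, 0 ≤ η x) (hη1 : ∀ x, η x ≤ 1)
    (hηs : Function.support η ⊆ Metric.closedBall 0 R) (hηc : ∀ x, ‖fderiv ℝ η x‖ ≤ c)
    (hτ0 : 0 ≤ τ) (hτ1 : τ ≤ 1) :
    ∫⁻ x, (ENNReal.ofReal (‖τ * (η x * mollify φ u x)‖ ^ P x) +
        ENNReal.ofReal (‖fderiv ℝ (fun x => τ * (η x * mollify φ u x)) x‖ ^ P x)) ≤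
      ENNReal.ofReal (τ * (1 + (2 * c) ^ pp)) *
        ((∫⁻ y, ENNReal.ofReal (‖u y‖ ^ p y)) + (∫⁻ y, ENNReal.ofReal (‖g y‖ ^ p y)) +
          2 * (ENNReal.ofReal σ * volume (Metric.closedBall (0 : RN N) R))) := by
  set S := Metric.closedBall (0 : RN N) R with hS
  have hmu : ContDiff ℝ 1 (mollify φ u) := contDiff_mollify φ hug.1
  have hmg : ContDiff ℝ 1 (mollify φ g) := contDiff_mollify φ hug.2.1
  have hP0 : ∀ x, 0 < P x := fun x => by linarith [hP1 x]
  set U : RN N → ℝ := fun x => τ * (η x * mollify φ u x) with hU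
  have hUts : tsupport U ⊆ S := by
    refine closure_minimal (fun x hx => hηs ?_) Metric.isClosed_closedBall
    rw [Function.mem_support] at hx ⊢
    contrapose! hx
    simp [hU, hx]
  have hc0 : 0 < c := by linarith
  have hpt : ∀ x, ENNReal.ofReal (‖U x‖ ^ P x) + ENNReal.ofReal (‖fderiv ℝ U x‖ ^ P x) ≤
      S.indicator (fun x => ENNReal.ofReal (τ * (1 + (2 * c) ^ pp)) *
        (ENNReal.ofReal (‖mollify φ u x‖ ^ P x) + ENNReal.ofReal (‖mollify φ g x‖ ^ P x))) x := by
    intro x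
    by_cases hx : x ∈ S
    swap
    · have h1 : x ∉ tsupport U := fun h => hx (hUts h)
      rw [fderiv_of_notMem_tsupport (𝕜 := ℝ) h1, image_eq_zero_of_notMem_tsupport h1]
      simp [Real.zero_rpow (hP0 x).ne']
    rw [Set.indicator_of_mem hx, ← ENNReal.ofReal_add (by positivity) (by positivity),
      ← ENNReal.ofReal_add (by positivity) (by positivity), ← ENNReal.ofReal_mul (by positivity)]
    refine ENNReal.ofReal_le_ofReal ?_
    have hτP : τ ^ P x ≤ τ := by
      rcases hτ0.eq_or_lt with h | h
      · rw [← h, Real.zero_rpow (hP0 x).ne']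
      · simpa using Real.rpow_le_rpow_of_exponent_ge h hτ1 (hP1 x)
    have hU1 : ‖U x‖ ^ P x ≤ τ * ‖mollify φ u x‖ ^ P x := by
      have h1 : ‖U x‖ ≤ τ * ‖mollify φ u x‖ := by
        rw [hU]
        simp only [norm_mul, Real.norm_of_nonneg hτ0, Real.norm_of_nonneg (hη0 x)]
        exact mul_le_mul_of_nonneg_left (mul_le_of_le_one_left (norm_nonneg _) (hη1 x)) hτ0
      calc ‖U x‖ ^ P x ≤ (τ * ‖mollify φ u x‖) ^ P x :=
            Real.rpow_le_rpow (norm_nonneg _) h1 (hP0 x).le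
        _ = τ ^ P x * ‖mollify φ u x‖ ^ P x := Real.mul_rpow hτ0 (norm_nonneg _)
        _ ≤ _ := by gcongr
    have hU2 : ‖fderiv ℝ U x‖ ≤
        τ * (2 * c * max ‖mollify φ u x‖ ‖mollify φ g x‖) := by
      have hd1 : DifferentiableAt ℝ η x := hη.differentiable one_ne_zero x
      have hd2 : DifferentiableAt ℝ (mollify φ u) x := hmu.differentiable one_ne_zero x
      have h1 : fderiv ℝ U x = τ • (η x • fderiv ℝ (mollify φ u) x +
          mollify φ u x • fderiv ℝ η x) := by
        rw [hU, fderiv_const_mul (hd1.fun_mul hd2), fderiv_fun_mul hd1 hd2]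
      rw [h1, norm_smul, Real.norm_of_nonneg hτ0]
      refine mul_le_mul_of_nonneg_left ((norm_add_le _ _).trans ?_) hτ0
      rw [norm_smul, norm_smul, Real.norm_of_nonneg (hη0 x)]
      have h2 := norm_fderiv_mollify_le φ hug x
      have h3 : η x * ‖fderiv ℝ (mollify φ u) x‖ ≤ max ‖mollify φ u x‖ ‖mollify φ g x‖ :=
        ((mul_le_of_le_one_left (norm_nonneg _) (hη1 x)).trans h2).trans (le_max_right _ _)
      have h4 : ‖mollify φ u x‖ * ‖fderiv ℝ η x‖ ≤ max ‖mollify φ u x‖ ‖mollify φ g x‖ * c :=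
        mul_le_mul (le_max_left _ _) (hηc x) (norm_nonneg _)
          ((norm_nonneg _).trans (le_max_left _ _))
      have h5 : max ‖mollify φ u x‖ ‖mollify φ g x‖ ≤ max ‖mollify φ u x‖ ‖mollify φ g x‖ * c :=
        le_mul_of_one_le_right ((norm_nonneg _).trans (le_max_left _ _)) hc
      linarith
    have hU3 : ‖fderiv ℝ U x‖ ^ P x ≤
        τ * ((2 * c) ^ pp * (‖mollify φ u x‖ ^ P x + ‖mollify φ g x‖ ^ P x)) := by
      have hm0 : 0 ≤ max ‖mollify φ u x‖ ‖mollify φ g x‖ :=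
        (norm_nonneg _).trans (le_max_left _ _)
      have hmax : max ‖mollify φ u x‖ ‖mollify φ g x‖ ^ P x ≤
          ‖mollify φ u x‖ ^ P x + ‖mollify φ g x‖ ^ P x := by
        rcases max_choice ‖mollify φ u x‖ ‖mollify φ g x‖ with h | h <;> rw [h]
        · exact le_add_of_nonneg_right (by positivity)
        · exact le_add_of_nonneg_left (by positivity)
      calc ‖fderiv ℝ U x‖ ^ P x ≤ (τ * (2 * c * max ‖mollify φ u x‖ ‖mollify φ g x‖)) ^ P x :=
            Real.rpow_le_rpow (norm_nonneg _) hU2 (hP0 x).le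
        _ = τ ^ P x * ((2 * c) ^ P x * max ‖mollify φ u x‖ ‖mollify φ g x‖ ^ P x) := by
            rw [Real.mul_rpow hτ0 (by positivity), Real.mul_rpow (by positivity) hm0]
        _ ≤ _ := by
            gcongr
            · linarith
            · exact hPpp x
    calc _ ≤ τ * ‖mollify φ u x‖ ^ P x +
          τ * ((2 * c) ^ pp * (‖mollify φ u x‖ ^ P x + ‖mollify φ g x‖ ^ P x)) :=
          add_le_add hU1 hU3
      _ ≤ τ * (‖mollify φ u x‖ ^ P x + ‖mollify φ g x‖ ^ P x) +
          τ * ((2 * c) ^ pp * (‖mollify φ u x‖ ^ P x + ‖mollify φ g x‖ ^ P x)) := by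
          gcongr
          exact le_add_of_nonneg_right (by positivity)
      _ = _ := by ring
  have hm1 : Measurable fun x => ENNReal.ofReal (‖mollify φ u x‖ ^ P x) :=
    (continuous_norm_rpow hmu.continuous hP hP0).measurable.ennreal_ofReal
  have hm2 : Measurable fun x => ENNReal.ofReal (‖mollify φ g x‖ ^ P x) :=
    (continuous_norm_rpow hmg.continuous hP hP0).measurable.ennreal_ofReal
  refine (lintegral_mono hpt).trans ?_
  rw [lintegral_indicator Metric.isClosed_closedBall.measurableSet,
    lintegral_const_mul _ (Measurable.fun_add hm1 hm2), lintegral_add_left hm1]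
  refine mul_le_mul_right ?_ _
  refine (add_le_add
    (lintegral_mollify_rpow_le φ hug.1.aestronglyMeasurable hp hP1 hσ hPp S)
    (lintegral_mollify_rpow_le φ hug.2.1.aestronglyMeasurable hp hP1 hσ hPp S)).trans
    (le_of_eq ?_)
  ring

lemma continuousAt_powCut {N : ℕ} {t s : ℝ} (hs : s ≠ N) :
    ContinuousAt (fun z : ℝ × ℝ => powCut N z.1 z.2) (t, s) :=
  (hasFDerivAt_powCut_comp (N := N) (x := ((t, s) : ℝ × ℝ)) hasFDerivAt_fst hasFDerivAt_snd
    hs).continuousAt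

/-- Smooth compactly supported functions and smooth exponents approximating a Sobolev function of
variable exponent, with uniformly bounded critical modular. -/
lemma exists_approx_lintegral_powCut_le {N : ℕ} (hN : 2 ≤ N) {p u : RN N → ℝ}
    {g : RN N → RN N} {pm pp : ℝ} {K : NNReal} (hp : LipschitzWith K p) (hpm : 1 < pm)
    (hpmp : ∀ x, pm ≤ p x) (hppp : ∀ x, p x ≤ pp) (hpp : pp < N) (hug : HasWeakGradient u g)
    (hu : ∫⁻ x, ENNReal.ofReal (‖u x‖ ^ p x) < ⊤) (hg : ∫⁻ x, ENNReal.ofReal (‖g x‖ ^ p x) < ⊤) :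
    ∃ a τ : ℝ, 0 < τ ∧ τ ≤ 1 ∧ ∃ (φ : ℕ → ContDiffBump (0 : RN N)) (η P : ℕ → RN N → ℝ),
      (∀ n, (φ n).rOut ≤ 1 / (n + 1)) ∧ (∀ n, (φ n).rOut ≤ 2 * (φ n).rIn) ∧
      (∀ (n : ℕ) x, ‖x‖ ≤ n → η n x = 1) ∧
      (∀ n x, |P n x - p x| ≤ 3 * K * (φ n).rOut) ∧
      (∀ n, Continuous fun x => powCut N (τ * (η n x * mollify (φ n) u x)) (P n x)) ∧
      ∀ n, ∫⁻ x, ENNReal.ofReal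
        (powCut N (τ * (η n x * mollify (φ n) u x)) (P n x) ^ ((N : ℝ) / (N - 1))) ≤
          ENNReal.ofReal a := by
  have hpp1 : 1 < pp := hpm.trans_le ((hpmp 0).trans (hppp 0))
  obtain ⟨a, ha, hmain⟩ := lintegral_powCut_le_of_modular_le hN hpp1 hpp K.coe_nonneg
  obtain ⟨c, hc1, hcut⟩ := exists_cutoff N
  have hc0 : 0 < c := by linarith
  -- The summand 2 is reserved for the two mollification errors, each made at most 1 below; it also
  -- makes T positive.
  obtain ⟨T, hT⟩ : ∃ z, z = (∫⁻ x, ENNReal.ofReal (‖u x‖ ^ p x)) +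
    (∫⁻ x, ENNReal.ofReal (‖g x‖ ^ p x)) + 2 := ⟨_, rfl⟩
  have hTtop : T ≠ ⊤ := by
    rw [hT]
    exact ENNReal.add_ne_top.2 ⟨ENNReal.add_ne_top.2 ⟨hu.ne, hg.ne⟩, by simp⟩
  have hT0 : 0 < T.toReal := by
    refine ENNReal.toReal_pos ?_ hTtop
    rw [hT]
    simp
  set A : ℝ := 1 + (2 * c) ^ pp with hA
  have hA0 : 0 < A := by positivity
  -- Chosen so that τ A T ≤ a, and independent of the approximation index, as the limit requires.
  set τ : ℝ := min 1 (a / (A * T.toReal)) with hτ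
  have hτ0 : 0 < τ := by positivity
  have hτT : ENNReal.ofReal (τ * A) * T ≤ ENNReal.ofReal a := by
    rw [← ENNReal.ofReal_toReal hTtop, ← ENNReal.ofReal_mul (by positivity)]
    refine ENNReal.ofReal_le_ofReal ?_
    calc τ * A * T.toReal ≤ a / (A * T.toReal) * A * T.toReal := by
          gcongr
          exact min_le_right _ _
      _ = a := by field_simp
  have hstep : ∀ n : ℕ, ∃ (φ : ContDiffBump (0 : RN N)) (η P : RN N → ℝ),
      φ.rOut ≤ 1 / (n + 1) ∧ φ.rOut ≤ 2 * φ.rIn ∧ (∀ x, ‖x‖ ≤ n → η x = 1) ∧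
      (∀ x, |P x - p x| ≤ 3 * K * φ.rOut) ∧
      (Continuous fun x => powCut N (τ * (η x * mollify φ u x)) (P x)) ∧
      ∫⁻ x, ENNReal.ofReal
        (powCut N (τ * (η x * mollify φ u x)) (P x) ^ ((N : ℝ) / (N - 1))) ≤
          ENNReal.ofReal a := by
    intro n
    obtain ⟨η, hη, hη0, hη1, hηR, hηs, hηc⟩ := hcut (n + 1) (by linarith [n.cast_nonneg (α := ℝ)])
    set S := Metric.closedBall (0 : RN N) (2 * ((n : ℝ) + 1)) with hS
    have hV : volume S ≠ ⊤ := measure_closedBall_lt_top.ne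
    set V := (volume S).toReal with hVdef
    have hV0 : 0 ≤ V := ENNReal.toReal_nonneg
    have hK0 : (0 : ℝ) ≤ K := K.coe_nonneg
    -- The three bounds make the radii tend to 0, keep the smoothed exponent above 1, and keep the
    -- error 4Kε times the volume of S at most 1. The terms K + 1 and V + 1 avoid division by zero.
    set ε : ℝ := min (1 / ((n : ℝ) + 1))
      (min ((pm - 1) / (4 * (K + 1))) (1 / (4 * (K + 1) * (V + 1)))) with hε
    have hpm0 : 0 < pm - 1 := by linarith
    have hε0 : 0 < ε := by positivity
    have hε1 : ε ≤ 1 / ((n : ℝ) + 1) := min_le_left _ _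
    have hε2 : 4 * (K + 1) * ε ≤ pm - 1 := by
      have : ε ≤ (pm - 1) / (4 * (K + 1)) := (min_le_right _ _).trans (min_le_left _ _)
      rwa [le_div_iff₀ (by positivity), mul_comm] at this
    have hε3 : 4 * K * ε * V ≤ 1 := by
      have : ε ≤ 1 / (4 * (K + 1) * (V + 1)) := (min_le_right _ _).trans (min_le_right _ _)
      rw [le_div_iff₀ (by positivity)] at this
      have h2 : 4 * K * ε * V ≤ 4 * (K + 1) * ε * (V + 1) := by gcongr <;> linarith
      linarith
    -- The fixed ratio of outer to inner radius is what almost everywhere convergence of the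
    -- mollifications needs.
    let φ : ContDiffBump (0 : RN N) := ⟨ε / 2, ε, by positivity, by linarith⟩
    have hφ : φ.rOut = ε := rfl
    -- The downward shift by 2Kε gives P x ≤ p y for |x - y| < ε: smoothing and moving from x to y
    -- cost Kε each. In the other direction the loss is at most 4Kε.
    set P : RN N → ℝ := fun x => mollify φ p x - 2 * K * ε with hPdef
    have hmol : ∀ x, |mollify φ p x - p x| ≤ K * ε := fun x => abs_mollify_sub_le φ hp x
    have hKε : 0 ≤ K * ε := by positivity
    have hPC : ContDiff ℝ 1 P :=
      (contDiff_mollify φ hp.continuous.locallyIntegrable).sub contDiff_const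
    have hP1 : ∀ x, 1 < P x := by
      intro x
      have h1 := abs_le.1 (hmol x)
      have h2 := hpmp x
      have h3 : P x = mollify φ p x - 2 * K * ε := rfl
      linarith [h1.1]
    have hPpp : ∀ x, P x ≤ pp := by
      intro x
      have h1 := abs_le.1 (hmol x)
      have h2 := hppp x
      have h3 : P x = mollify φ p x - 2 * K * ε := rfl
      linarith [h1.2]
    have hPK : ∀ x, ‖fderiv ℝ P x‖ ≤ K := by
      intro x
      rw [hPdef, fderiv_sub_const]
      exact norm_fderiv_mollify_le_of_lipschitz φ hp x
    have hPp : ∀ x y, ‖x - y‖ < φ.rOut → P x ≤ p y ∧ p y ≤ P x + 4 * K * ε := by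
      intro x y hxy
      have h1 := abs_le.1 (hmol x)
      have h3 : P x = mollify φ p x - 2 * K * ε := rfl
      have h4 : |p x - p y| ≤ K * ε := by
        refine (hp.dist_le_mul x y).trans ?_
        rw [dist_eq_norm]
        gcongr
      have h5 := abs_le.1 h4
      constructor
      · linarith [h1.2, h5.1]
      · linarith [h1.1, h5.1]
    have hUC : ContDiff ℝ 1 fun x => τ * (η x * mollify φ u x) :=
      contDiff_const.mul (hη.mul (contDiff_mollify φ hug.1))
    have hUc : HasCompactSupport fun x => τ * (η x * mollify φ u x) := by
      refine HasCompactSupport.of_support_subset_isCompact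
        (isCompact_closedBall (0 : RN N) (2 * ((n : ℝ) + 1))) (fun x hx => hηs ?_)
      rw [Function.mem_support] at hx ⊢
      contrapose! hx
      simp [hx]
    refine ⟨φ, η, P, hε1, ?_, fun x hx => hηR x (by linarith), fun x => ?_,
      (contDiff_powCut_comp hUC hPC fun x => (hPpp x).trans_lt hpp).continuous,
      hmain P _ hPC hP1 hPpp hPK hUC hUc ?_⟩
    · show ε ≤ 2 * (ε / 2)
      linarith
    · have h1 := abs_le.1 (hmol x)
      have h3 : P x = mollify φ p x - 2 * K * ε := rfl
      rw [hφ, abs_le]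
      constructor <;> linarith [h1.1, h1.2]
    · refine (lintegral_modular_cutoff_mollify_le φ hug hp.continuous hPC.continuous
        (fun x => (hP1 x).le) hPpp (by positivity : 0 ≤ 4 * K * ε) hPp hc1 hη hη0 hη1 hηs hηc
        hτ0.le (min_le_left _ _)).trans (le_trans ?_ hτT)
      rw [hT]
      gcongr
      have : ENNReal.ofReal (4 * K * ε) * volume S ≤ 1 := by
        rw [← ENNReal.ofReal_toReal hV, ← ENNReal.ofReal_mul (by positivity)]
        exact ENNReal.ofReal_le_one.2 hε3
      calc 2 * (ENNReal.ofReal (4 * K * ε) * volume S) ≤ 2 * 1 := by gcongr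
        _ = 2 := mul_one _
  choose φ η P h1 h2 h3 h4 h5 h6 using hstep
  exact ⟨a, τ, hτ0, min_le_left _ _, φ, η, P, h1, h2, h3, h4, h5, h6⟩

/-! ### Passage to the limit and the variable exponent Sobolev embedding -/

/-- Finiteness of the critical modular of a small multiple of a Sobolev function. -/
lemma exists_lintegral_powCut_lt_top {N : ℕ} (hN : 2 ≤ N) {p u : RN N → ℝ}
    {g : RN N → RN N} {pm pp : ℝ} {K : NNReal} (hp : LipschitzWith K p) (hpm : 1 < pm)
    (hpmp : ∀ x, pm ≤ p x) (hppp : ∀ x, p x ≤ pp) (hpp : pp < N) (hug : HasWeakGradient u g)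
    (hu : ∫⁻ x, ENNReal.ofReal (‖u x‖ ^ p x) < ⊤) (hg : ∫⁻ x, ENNReal.ofReal (‖g x‖ ^ p x) < ⊤) :
    ∃ τ : ℝ, 0 < τ ∧ τ ≤ 1 ∧
      ∫⁻ x, ENNReal.ofReal (powCut N (τ * u x) (p x) ^ ((N : ℝ) / (N - 1))) < ⊤ := by
  obtain ⟨a, τ, hτ0, hτ1, φ, η, P, hφ1, hφ2, hη, hP, hcont, hbd⟩ :=
    exists_approx_lintegral_powCut_le hN hp hpm hpmp hppp hpp hug hu hg
  refine ⟨τ, hτ0, hτ1, lt_of_le_of_lt ?_ (ENNReal.ofReal_lt_top (r := a))⟩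
  have hN2 : (2 : ℝ) ≤ N := by exact_mod_cast hN
  have hn0 : 0 < (N : ℝ) / (N - 1) := div_pos (by linarith) (by linarith)
  have hrOut : Filter.Tendsto (fun n => (φ n).rOut) Filter.atTop (nhds 0) :=
    squeeze_zero (fun n => (φ n).rOut_pos.le) hφ1 tendsto_one_div_add_atTop_nhds_zero_nat
  have hae := ContDiffBump.ae_convolution_tendsto_right_of_locallyIntegrable (μ := volume)
    hrOut (K := 2) (Filter.Eventually.of_forall hφ2) hug.1
  have hlim : ∀ᵐ x, Filter.Tendsto (fun n => ENNReal.ofReal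
      (powCut N (τ * (η n x * mollify (φ n) u x)) (P n x) ^ ((N : ℝ) / (N - 1)))) Filter.atTop
      (nhds (ENNReal.ofReal (powCut N (τ * u x) (p x) ^ ((N : ℝ) / (N - 1))))) := by
    filter_upwards [hae] with x hx
    have hPx : Filter.Tendsto (fun n => P n x) Filter.atTop (nhds (p x)) := by
      rw [tendsto_iff_dist_tendsto_zero]
      refine squeeze_zero (fun n => dist_nonneg) (fun n => hP n x) ?_
      simpa using hrOut.const_mul (3 * (K : ℝ))
    have hηx : Filter.Tendsto (fun n => η n x) Filter.atTop (nhds 1) := by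
      refine tendsto_const_nhds.congr' ?_
      filter_upwards [Filter.eventually_ge_atTop ⌈‖x‖⌉₊] with n hn
      exact (hη n x ((Nat.le_ceil _).trans (by exact_mod_cast hn))).symm
    have hUx : Filter.Tendsto (fun n => τ * (η n x * mollify (φ n) u x)) Filter.atTop
        (nhds (τ * u x)) := by
      have := (hηx.mul hx).const_mul τ
      rwa [one_mul] at this
    have hne : p x ≠ N := ((hppp x).trans_lt hpp).ne
    have := (continuousAt_powCut (t := τ * u x) hne).tendsto.comp (hUx.prodMk_nhds hPx)
    exact (ENNReal.continuous_ofReal.tendsto _).comp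
      ((Real.continuousAt_rpow_const _ _ (Or.inr hn0.le)).tendsto.comp this)
  -- Fatou's lemma: pointwise convergence almost everywhere and the uniform bound suffice.
  calc ∫⁻ x, ENNReal.ofReal (powCut N (τ * u x) (p x) ^ ((N : ℝ) / (N - 1)))
      = ∫⁻ x, Filter.liminf (fun n => ENNReal.ofReal
        (powCut N (τ * (η n x * mollify (φ n) u x)) (P n x) ^ ((N : ℝ) / (N - 1))))
          Filter.atTop := by
        refine lintegral_congr_ae ?_
        filter_upwards [hlim] with x hx
        exact hx.liminf_eq.symm
    _ ≤ Filter.liminf (fun n => ∫⁻ x, ENNReal.ofReal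
        (powCut N (τ * (η n x * mollify (φ n) u x)) (P n x) ^ ((N : ℝ) / (N - 1))))
          Filter.atTop :=
        lintegral_liminf_le fun n =>
          ((hcont n).rpow_const fun x => Or.inr hn0.le).measurable.ennreal_ofReal
    _ ≤ ENNReal.ofReal a :=
        Filter.liminf_le_of_le (by isBoundedDefault) fun b hb => by
          obtain ⟨n, hn⟩ := hb.exists
          exact hn.trans (hbd n)

/-- Where t² ≥ 2 the cutoff is 1 and the first term has full critical growth. Elsewhere |t|/2 ≤ 1,
so lowering the exponent from σ to s only increases the power of |t|/2; extracting 2^σ gives the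
constant. -/
lemma rpow_le_powCut_add {N : ℕ} (hN : 2 ≤ N) {t s σ pp : ℝ} (hs : 1 < s) (hspp : s ≤ pp)
    (hpp : pp < N) (hsσ : s ≤ σ) (hσ : σ ≤ N * s / (N - s)) :
    |t| ^ σ ≤ powCut N t s ^ ((N : ℝ) / (N - 1)) + 2 ^ ((N : ℝ) * pp / (N - pp)) * |t| ^ s := by
  have hN2 : (2 : ℝ) ≤ N := by exact_mod_cast hN
  have hN1 : 0 < (N : ℝ) - 1 := by linarith
  have hNs : 0 < (N : ℝ) - s := by linarith
  have hNpp : 0 < (N : ℝ) - pp := by linarith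
  rcases le_or_gt 2 (t ^ 2) with h | h
  · have hW0 : 0 < 1 + t ^ 2 := by positivity
    have h1 : powCut N t s ^ ((N : ℝ) / (N - 1)) = (1 + t ^ 2) ^ (N * s / (N - s) / 2) := by
      rw [powCut, Real.smoothTransition.one_of_one_le (by linarith), one_mul,
        mul_comm (chainExp N s / 2), ← Real.rpow_def_of_pos hW0, ← Real.rpow_mul hW0.le]
      congr 1
      rw [chainExp]
      field_simp
    have ht1 : 1 ≤ |t| := (one_le_sq_iff_one_le_abs t).1 (by linarith)
    have h2 : |t| ^ σ ≤ (1 + t ^ 2) ^ (N * s / (N - s) / 2) := by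
      calc |t| ^ σ ≤ |t| ^ (N * s / (N - s)) := Real.rpow_le_rpow_of_exponent_le ht1 hσ
        _ = (t ^ 2) ^ (N * s / (N - s) / 2) := by
            rw [← sq_abs, ← Real.rpow_natCast, ← Real.rpow_mul (abs_nonneg t)]
            congr 1
            push_cast
            ring
        _ ≤ _ := Real.rpow_le_rpow (by positivity) (by linarith) (by positivity)
    rw [h1]
    exact h2.trans (le_add_of_nonneg_right (by positivity))
  · have ht2 : |t| / 2 ≤ 1 := by
      have : |t| ≤ 2 := abs_le.2 (abs_le_of_sq_le_sq' (by linarith) (by norm_num))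
      linarith
    have h1 : |t| ^ σ ≤ 2 ^ ((N : ℝ) * pp / (N - pp)) * |t| ^ s := by
      have e : |t| = 2 * (|t| / 2) := by ring
      calc |t| ^ σ = 2 ^ σ * (|t| / 2) ^ σ := by
            conv_lhs => rw [e]
            rw [Real.mul_rpow (by norm_num) (by positivity)]
        _ ≤ 2 ^ ((N : ℝ) * pp / (N - pp)) * |t| ^ s := by
            gcongr
            · norm_num
            · refine hσ.trans ?_
              have : 0 ≤ (N : ℝ) * pp := mul_nonneg (by linarith) (by linarith)
              gcongr
            · calc (|t| / 2) ^ σ ≤ (|t| / 2) ^ s :=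
                    Real.rpow_le_rpow_of_exponent_ge' (by positivity) ht2 (by linarith) hsσ
                _ ≤ |t| ^ s := by
                    gcongr
                    linarith [abs_nonneg t]
    exact h1.trans (le_add_of_nonneg_left (Real.rpow_nonneg (powCut_nonneg _ _ _) _))

/-- The Sobolev embedding `W^{1,p(x)}(ℝᴺ) ⊆ L^{s(x)}(ℝᴺ)` for Lipschitz `p` and `p ≤ s ≤ p*`. -/
theorem lintegral_rpow_lt_top_of_memVarSobolev {N : ℕ} (hN : 2 ≤ N) {p s u : RN N → ℝ}
    {pm pp : ℝ} {K : NNReal} (hp : LipschitzWith K p) (hpm : 1 < pm) (hpmp : ∀ x, pm ≤ p x)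
    (hppp : ∀ x, p x ≤ pp) (hpp : pp < N) (hps : ∀ x, p x ≤ s x)
    (hsp : ∀ x, s x ≤ criticalExp p x) (hu : MemVarSobolev p u) :
    ∫⁻ x, ENNReal.ofReal (|u x| ^ s x) < ⊤ := by
  obtain ⟨⟨hum, hup⟩, g, hug, -, hgp⟩ := hu
  obtain ⟨τ, hτ0, hτ1, hτ⟩ :=
    exists_lintegral_powCut_lt_top hN hp hpm hpmp hppp hpp hug hup hgp
  have hNpp : 0 < (N : ℝ) - pp := by linarith
  have hpp0 : 0 < pp := by linarith [hpmp 0, hppp 0]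
  set Γ : ℝ := (N : ℝ) * pp / (N - pp) with hΓ
  have hΓ0 : 0 ≤ Γ := by positivity
  -- Only τ u is known to have finite critical modular. Writing u = τ⁻¹(τ u) costs τ^{-s x} ≤
  -- τ^{-Γ}, uniformly in x, because Γ bounds all critical exponents.
  have hpt : ∀ x, ENNReal.ofReal (|u x| ^ s x) ≤ ENNReal.ofReal (τ ^ (-Γ)) *
      (ENNReal.ofReal (powCut N (τ * u x) (p x) ^ ((N : ℝ) / (N - 1))) +
        ENNReal.ofReal (2 ^ Γ) * ENNReal.ofReal (‖u x‖ ^ p x)) := by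
    intro x
    have hp1 : 1 < p x := hpm.trans_le (hpmp x)
    have hs0 : 0 < s x := by linarith [hps x]
    have hNp : 0 < (N : ℝ) - p x := by linarith [hppp x]
    have hsΓ : s x ≤ Γ := by
      refine (hsp x).trans ?_
      rw [criticalExp, hΓ]
      have := hppp x
      gcongr
    have hv0 : 0 ≤ powCut N (τ * u x) (p x) ^ ((N : ℝ) / (N - 1)) :=
      Real.rpow_nonneg (powCut_nonneg _ _ _) _
    rw [← ENNReal.ofReal_mul (by positivity), ← ENNReal.ofReal_add hv0 (by positivity),
      ← ENNReal.ofReal_mul (by positivity)]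
    refine ENNReal.ofReal_le_ofReal ?_
    have h1 := rpow_le_powCut_add hN (t := τ * u x) hp1 (hppp x) hpp (hps x) (hsp x)
    have h2 : |u x| ^ s x = τ ^ (-s x) * |τ * u x| ^ s x := by
      rw [abs_mul, abs_of_pos hτ0, Real.mul_rpow hτ0.le (abs_nonneg _), ← mul_assoc,
        ← Real.rpow_add hτ0, neg_add_cancel, Real.rpow_zero, one_mul]
    have h3 : |τ * u x| ^ p x ≤ ‖u x‖ ^ p x := by
      refine Real.rpow_le_rpow (abs_nonneg _) ?_ (by linarith)
      rw [abs_mul, abs_of_pos hτ0]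
      exact mul_le_of_le_one_left (abs_nonneg _) hτ1
    rw [h2]
    refine mul_le_mul (Real.rpow_le_rpow_of_exponent_ge hτ0 hτ1 (by linarith)) (h1.trans ?_)
      (by positivity) (by positivity)
    gcongr
  have hum' : AEMeasurable fun x => ENNReal.ofReal (‖u x‖ ^ p x) :=
    (hum.norm.aemeasurable.pow hp.continuous.aemeasurable).ennreal_ofReal
  refine (lintegral_mono hpt).trans_lt ?_
  rw [lintegral_const_mul' _ _ ENNReal.ofReal_ne_top, lintegral_add_right' _ (hum'.const_mul _),
    lintegral_const_mul' _ _ ENNReal.ofReal_ne_top]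
  exact ENNReal.mul_lt_top ENNReal.ofReal_lt_top
    (ENNReal.add_lt_top.2 ⟨hτ, ENNReal.mul_lt_top ENNReal.ofReal_lt_top hup⟩)

/-! ### Kernels of variable order and the conclusion -/

/-- The exponent relation determines λ from q, which supplies the measurability, boundedness and
two-sided bounds of λ. -/
lemma eq_mul_two_sub {n a b l : ℝ} (hn : n ≠ 0) (h : 1 / a + l / n + 1 / b = 2) :
    l = n * (2 - 1 / a - 1 / b) := by
  rw [show 2 - 1 / a - 1 / b = l / n by linarith, mul_div_cancel₀ _ hn]

/-- A power with exponent between `l₁` and `l₂` is dominated by the two extreme powers. -/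
lemma inv_rpow_le_add {t l₁ l₂ l : ℝ} (ht : 0 ≤ t) (hl1 : 0 < l₁) (h1 : l₁ ≤ l) (h2 : l ≤ l₂) :
    (t ^ l)⁻¹ ≤ t ^ (-l₂) + t ^ (-l₁) := by
  -- At t = 0 the left side is 0 by the convention for inverses.
  rcases ht.eq_or_lt with h0 | h0
  · rw [← h0, Real.zero_rpow (by linarith), inv_zero]
    positivity
  rw [← Real.rpow_neg ht]
  rcases le_total t 1 with h | h
  · exact (Real.rpow_le_rpow_of_exponent_ge h0 h (by linarith)).trans
      (le_add_of_nonneg_right (by positivity))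
  · exact (Real.rpow_le_rpow_of_exponent_le h (by linarith)).trans
      (le_add_of_nonneg_left (by positivity))

/-- The Hardy-Littlewood-Sobolev inequality with the Lebesgue exponent as parameter. -/
lemma hardy_littlewood_sobolev_exponent {N : ℕ} (hN : 0 < N) {Q : ℝ} (hQ : 1 < Q)
    (hQN : 2 * N * (1 - 1 / Q) < N) :
    ∃ C : ℝ, 0 < C ∧ ∀ (f : RN N → ℝ), AEMeasurable f → (∀ x, 0 ≤ f x) →
      ∫⁻ x, ∫⁻ y, ENNReal.ofReal (f x) * ENNReal.ofReal (f y) *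
          ENNReal.ofReal (‖x - y‖ ^ (-(2 * N * (1 - 1 / Q)))) ≤
        ENNReal.ofReal C * eLpNorm f (ENNReal.ofReal Q) volume ^ 2 := by
  have hN' : (0 : ℝ) < N := by exact_mod_cast hN
  have hQ1 : 0 < 1 - 1 / Q := by
    rw [sub_pos, div_lt_one (by linarith)]
    exact hQ
  have h := hardy_littlewood_sobolev hN (l := 2 * N * (1 - 1 / Q)) (by positivity) hQN
  have e : 2 * (N : ℝ) / (2 * N - 2 * N * (1 - 1 / Q)) = Q := by
    have : 2 * (N : ℝ) - 2 * N * (1 - 1 / Q) = 2 * N / Q := by ring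
    rw [this]
    field_simp
  rwa [e] at h

/-- The Hardy-Littlewood-Sobolev inequality for a kernel of variable order, tested on the diagonal.
-/
lemma variable_hardy_littlewood_sobolev {N : ℕ} (hN : 0 < N) {q : RN N → ℝ}
    {lam : RN N × RN N → ℝ} (hq : IsCPlus q)
    (hsym : ∀ x y, 1 / q x + lam (x, y) / N + 1 / q y = 2) (hlam : upperExp lam < N) :
    ∃ C : ℝ, 0 < C ∧ ∀ (f : RN N → ℝ), AEMeasurable f → (∀ x, 0 ≤ f x) →
      ∫⁻ z : RN N × RN N, ENNReal.ofReal (f z.1 * f z.2 / ‖z.1 - z.2‖ ^ lam z)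
          ∂(volume.prod volume) ≤
        ENNReal.ofReal C * (eLpNorm f (ENNReal.ofReal (upperExp q)) volume ^ 2 +
          eLpNorm f (ENNReal.ofReal (lowerExp q)) volume ^ 2) := by
  have hN' : (0 : ℝ) < N := by exact_mod_cast hN
  have hqm : ∀ x, lowerExp q ≤ q x := fun x => ciInf_le hq.bddBelow x
  have hqp : ∀ x, q x ≤ upperExp q := fun x => le_ciSup hq.bddAbove x
  have hm1 := hq.one_lt
  have hmp : lowerExp q ≤ upperExp q := (hqm 0).trans (hqp 0)
  have hq1 : ∀ x, 1 < q x := fun x => hm1.trans_le (hqm x)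
  have hlam_eq : ∀ z, lam z = N * (2 - 1 / q z.1 - 1 / q z.2) := fun z =>
    eq_mul_two_sub hN'.ne' (hsym z.1 z.2)
  -- Without boundedness `upperExp lam` would be a default value rather than a supremum.
  have hbdd : BddAbove (Set.range lam) := by
    refine ⟨2 * N, ?_⟩
    rintro _ ⟨z, rfl⟩
    rw [hlam_eq]
    have h1 : 0 < 1 / q z.1 := one_div_pos.2 (by linarith [hq1 z.1])
    have h2 : 0 < 1 / q z.2 := one_div_pos.2 (by linarith [hq1 z.2])
    nlinarith
  have hΛ : ∀ z, lam z ≤ upperExp lam := fun z => le_ciSup hbdd z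
  -- The diagonal value λ(x,x) = 2N(1 - 1/q(x)) is at most λ⁺, so q(x) ≤ 2N/(2N - λ⁺). The same
  -- bound passes to q⁺ and gives 2N(1 - 1/q⁺) ≤ λ⁺ < N.
  have hup : 2 * N * (1 - 1 / upperExp q) < N := by
    have hΛ2 : 0 < 2 * N - upperExp lam := by linarith
    have hle : upperExp q ≤ 2 * N / (2 * N - upperExp lam) := by
      refine ciSup_le fun x => ?_
      have h1 := hΛ (x, x)
      rw [hlam_eq] at h1
      have hx : 0 < q x := by linarith [hq1 x]
      rw [le_div_iff₀ hΛ2]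
      have h2 : N * (2 - 1 / q x - 1 / q x) * q x = 2 * N * q x - 2 * N := by
        field_simp
        ring
      have h3 := mul_le_mul_of_nonneg_right h1 hx.le
      rw [h2] at h3
      linarith
    have h4 : 0 < upperExp q := by linarith
    rw [le_div_iff₀ hΛ2] at hle
    have h5 : 2 * N * (1 - 1 / upperExp q) = (2 * N * upperExp q - 2 * N) / upperExp q := by
      field_simp
    rw [h5, div_lt_iff₀ h4]
    nlinarith
  have hmono : 2 * N * (1 - 1 / lowerExp q) ≤ 2 * N * (1 - 1 / upperExp q) := by
    have : 1 / upperExp q ≤ 1 / lowerExp q := one_div_le_one_div_of_le (by linarith) hmp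
    nlinarith
  obtain ⟨C₁, hC₁, h₁⟩ := hardy_littlewood_sobolev_exponent hN (hm1.trans_le hmp) hup
  obtain ⟨C₂, hC₂, h₂⟩ := hardy_littlewood_sobolev_exponent hN hm1 (hmono.trans_lt hup)
  set l₂ : ℝ := 2 * N * (1 - 1 / upperExp q) with hl₂
  set l₁ : ℝ := 2 * N * (1 - 1 / lowerExp q) with hl₁
  have hl₁0 : 0 < l₁ := by
    have : 0 < 1 - 1 / lowerExp q := by
      rw [sub_pos, div_lt_one (by linarith)]
      exact hm1
    positivity
  have hlam1 : ∀ z, l₁ ≤ lam z := by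
    intro z
    rw [hlam_eq, hl₁]
    have h1 : 1 / q z.1 ≤ 1 / lowerExp q := one_div_le_one_div_of_le (by linarith) (hqm _)
    have h2 : 1 / q z.2 ≤ 1 / lowerExp q := one_div_le_one_div_of_le (by linarith) (hqm _)
    nlinarith
  have hlam2 : ∀ z, lam z ≤ l₂ := by
    intro z
    rw [hlam_eq, hl₂]
    have h1 : 1 / upperExp q ≤ 1 / q z.1 :=
      one_div_le_one_div_of_le (by linarith [hq1 z.1]) (hqp _)
    have h2 : 1 / upperExp q ≤ 1 / q z.2 :=
      one_div_le_one_div_of_le (by linarith [hq1 z.2]) (hqp _)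
    nlinarith
  refine ⟨max C₁ C₂, by positivity, fun f hf hf0 => ?_⟩
  have hker : ∀ l : ℝ, AEMeasurable (fun z : RN N × RN N => ENNReal.ofReal (f z.1) *
      ENNReal.ofReal (f z.2) * ENNReal.ofReal (‖z.1 - z.2‖ ^ (-l))) (volume.prod volume) := by
    intro l
    have hm : Measurable fun z : RN N × RN N => ‖z.1 - z.2‖ ^ (-l) := by fun_prop
    exact (hf.comp_fst.ennreal_ofReal.mul hf.comp_snd.ennreal_ofReal).mul
      hm.ennreal_ofReal.aemeasurable
  calc _ ≤ ∫⁻ z : RN N × RN N,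
        (ENNReal.ofReal (f z.1) * ENNReal.ofReal (f z.2) * ENNReal.ofReal (‖z.1 - z.2‖ ^ (-l₂)) +
          ENNReal.ofReal (f z.1) * ENNReal.ofReal (f z.2) * ENNReal.ofReal (‖z.1 - z.2‖ ^ (-l₁)))
            ∂(volume.prod volume) := by
        refine lintegral_mono fun z => ?_
        have hx := hf0 z.1
        have hy := hf0 z.2
        rw [← mul_add, ← ENNReal.ofReal_add (by positivity) (by positivity),
          ← ENNReal.ofReal_mul hx, ← ENNReal.ofReal_mul (by positivity), div_eq_mul_inv]
        refine ENNReal.ofReal_le_ofReal (mul_le_mul_of_nonneg_left ?_ (by positivity))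
        exact inv_rpow_le_add (norm_nonneg _) hl₁0 (hlam1 z) (hlam2 z)
    _ ≤ ENNReal.ofReal C₁ * eLpNorm f (ENNReal.ofReal (upperExp q)) volume ^ 2 +
        ENNReal.ofReal C₂ * eLpNorm f (ENNReal.ofReal (lowerExp q)) volume ^ 2 := by
        rw [lintegral_add_left' (hker l₂), lintegral_prod _ (hker l₂), lintegral_prod _ (hker l₁)]
        exact add_le_add (h₁ f hf hf0) (h₂ f hf hf0)
    _ ≤ _ := by
        rw [mul_add]
        gcongr
        · exact le_max_left _ _
        · exact le_max_right _ _

lemma memLp_abs_rpow {N : ℕ} {u r : RN N → ℝ} {Q : ℝ} (hQ : 0 < Q)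
    (hu : AEStronglyMeasurable u volume) (hr : Continuous r)
    (h : ∫⁻ x, ENNReal.ofReal (|u x| ^ (r x * Q)) < ⊤) :
    MemLp (fun x => |u x| ^ r x) (ENNReal.ofReal Q) volume := by
  have hm : AEMeasurable (fun x => |u x| ^ r x) :=
    hu.norm.aemeasurable.pow hr.aemeasurable
  refine ⟨hm.aestronglyMeasurable, ?_⟩
  rw [eLpNorm_lt_top_iff_lintegral_rpow_enorm_lt_top (by simpa using hQ) ENNReal.ofReal_ne_top,
    ENNReal.toReal_ofReal hQ.le]
  refine lt_of_eq_of_lt (lintegral_congr fun x => ?_) h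
  rw [Real.enorm_of_nonneg (by positivity), ENNReal.ofReal_rpow_of_nonneg (by positivity) hQ.le,
    ← Real.rpow_mul (abs_nonneg _)]

theorem corollary2p6 (N : ℕ) (p q r : RN N → ℝ) (lam : RN N × RN N → ℝ)
    (hp : IsCPlus p) (hp_lip : ∃ K, LipschitzWith K p) (hpN : upperExp p < N)
    (hq : IsCPlus q)
    (hsym : ∀ x y, 1 / q x + lam (x, y) / N + 1 / q y = 2)
    (hlam : upperExp lam < N)
    (hr : IsAdmissible p q r) :
    (∀ u : RN N → ℝ, MemVarSobolev p u →
      MemLp (fun x => |u x| ^ r x) (ENNReal.ofReal (lowerExp q)) volume ∧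
      MemLp (fun x => |u x| ^ r x) (ENNReal.ofReal (upperExp q)) volume) ∧
    ∃ C : ℝ, 0 < C ∧ ∀ u : RN N → ℝ, MemVarSobolev p u →
      Integrable (fun z : RN N × RN N =>
        |u z.1| ^ r z.1 * |u z.2| ^ r z.2 / ‖z.1 - z.2‖ ^ lam z) (volume.prod volume) ∧
      |∫ y, ∫ x, |u x| ^ r x * |u y| ^ r y / ‖x - y‖ ^ lam (x, y)| ≤
        C * (lpNormReal (upperExp q) (fun x => |u x| ^ r x) ^ 2 +
          lpNormReal (lowerExp q) (fun x => |u x| ^ r x) ^ 2) := by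
  obtain ⟨K, hK⟩ := hp_lip
  have hpm : ∀ x, lowerExp p ≤ p x := fun x => ciInf_le hp.bddBelow x
  have hpp : ∀ x, p x ≤ upperExp p := fun x => le_ciSup hp.bddAbove x
  -- The chain 1 < p⁻ ≤ p⁺ < N excludes dimensions 0 and 1.
  have hN2 : 2 ≤ N := by
    have : (1 : ℝ) < N := ((hp.one_lt.trans_le (hpm 0)).trans_le (hpp 0)).trans hpN
    have : 1 < N := by exact_mod_cast this
    omega
  have hN : 0 < N := by omega
  have hN' : (0 : ℝ) < N := by exact_mod_cast hN
  have hmp : lowerExp q ≤ upperExp q :=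
    (ciInf_le hq.bddBelow 0).trans (le_ciSup hq.bddAbove 0)
  have hm0 : 0 < lowerExp q := by linarith [hq.one_lt]
  have hmem : ∀ u : RN N → ℝ, MemVarSobolev p u →
      MemLp (fun x => |u x| ^ r x) (ENNReal.ofReal (lowerExp q)) volume ∧
      MemLp (fun x => |u x| ^ r x) (ENNReal.ofReal (upperExp q)) volume := by
    intro u hu
    exact ⟨memLp_abs_rpow hm0 hu.1.1 hr.isCPlus.continuous
        (lintegral_rpow_lt_top_of_memVarSobolev hN2 hK hp.one_lt hpm hpp hpN hr.le_lower
          (fun x => (hr.lower_le_upper x).trans (hr.upper_le x)) hu),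
      memLp_abs_rpow (hm0.trans_le hmp) hu.1.1 hr.isCPlus.continuous
        (lintegral_rpow_lt_top_of_memVarSobolev hN2 hK hp.one_lt hpm hpp hpN
          (fun x => (hr.le_lower x).trans (hr.lower_le_upper x)) hr.upper_le hu)⟩
  refine ⟨hmem, ?_⟩
  obtain ⟨C, hC, hHLS⟩ := variable_hardy_littlewood_sobolev hN hq hsym hlam
  refine ⟨C, hC, fun u hu => ?_⟩
  obtain ⟨⟨-, hlow⟩, hfm, hupp⟩ := hmem u hu
  have hf0 : ∀ x, 0 ≤ |u x| ^ r x := fun x => by positivity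
  have hbd := hHLS _ hfm.aemeasurable hf0
  set f : RN N → ℝ := fun x => |u x| ^ r x with hf
  set k : RN N × RN N → ℝ := fun z => f z.1 * f z.2 / ‖z.1 - z.2‖ ^ lam z with hk
  have hk0 : ∀ z, 0 ≤ k z := fun z =>
    div_nonneg (mul_nonneg (hf0 _) (hf0 _)) (Real.rpow_nonneg (norm_nonneg _) _)
  have hlamm : Measurable lam := by
    have : lam = fun z => N * (2 - 1 / q z.1 - 1 / q z.2) :=
      funext fun z => eq_mul_two_sub hN'.ne' (hsym z.1 z.2)
    rw [this]
    have hqm := hq.continuous.measurable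
    fun_prop
  have hkm : AEStronglyMeasurable k (volume.prod volume) := by
    have h1 : Measurable fun z : RN N × RN N => ‖z.1 - z.2‖ := by fun_prop
    exact ((hfm.aemeasurable.comp_fst.mul hfm.aemeasurable.comp_snd).div
      (h1.pow hlamm).aemeasurable).aestronglyMeasurable
  have hBtop : ENNReal.ofReal C * (eLpNorm f (ENNReal.ofReal (upperExp q)) volume ^ 2 +
      eLpNorm f (ENNReal.ofReal (lowerExp q)) volume ^ 2) ≠ ⊤ :=
    ENNReal.mul_ne_top ENNReal.ofReal_ne_top
      (ENNReal.add_ne_top.2 ⟨ENNReal.pow_ne_top hupp.ne, ENNReal.pow_ne_top hlow.ne⟩)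
  have henorm : ∫⁻ z, ‖k z‖ₑ ∂(volume.prod volume) =
      ∫⁻ z, ENNReal.ofReal (k z) ∂(volume.prod volume) :=
    lintegral_congr fun z => Real.enorm_of_nonneg (hk0 z)
  have hint : Integrable k (volume.prod volume) := by
    refine ⟨hkm, ?_⟩
    rw [HasFiniteIntegral, henorm]
    exact hbd.trans_lt hBtop.lt_top
  refine ⟨hint, ?_⟩
  -- The iterated integral has x innermost, hence the symmetric form of Fubini.
  have hswap : ∫ y, ∫ x, f x * f y / ‖x - y‖ ^ lam (x, y) = ∫ z, k z ∂(volume.prod volume) :=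
    (integral_prod_symm k hint).symm
  have h1 : ‖∫ z, k z ∂(volume.prod volume)‖ₑ ≤ _ :=
    (enorm_integral_le_lintegral_enorm k).trans (henorm.le.trans hbd)
  have h2 := ENNReal.toReal_mono hBtop h1
  rw [toReal_enorm, ENNReal.toReal_mul, ENNReal.toReal_ofReal hC.le,
    ENNReal.toReal_add (ENNReal.pow_ne_top hupp.ne) (ENNReal.pow_ne_top hlow.ne),
    ENNReal.toReal_pow, ENNReal.toReal_pow, Real.norm_eq_abs, ← hswap] at h2
  exact h2
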